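/- Let $p$ be a prime number and let $R$ be a connected commutative ring in which $p=0$. Let $\sigma\subseteq\mathbb{R}^n$ be a convex cone (a nonempty convex subset closed under multiplication by nonnegative real numbers; no finite generation, rationality or closedness is assumed), and let $\lambda:\mathbb{R}^n\to\mathbb{R}$ be a linear functional. For a convex cone $\rho$ write $R_\rho=R[\rho\cap\mathbb{Z}^n]$ for the monoid algebra. Define $v_\lambda$ on $R_\sigma$ by $$v_\lambda\Bigl(\sum_{\mathbf v} c_{\mathbf v}[\mathbf v]\Bigr)=\min\{\lambda(\mathbf v): c_{\mathbf v}\neq 0\}\qquad (v_\lambda(0)=+\infty),$$ let $R_{\sigma,\lambda}$ be the completion of $R_\sigma$ for the ring topology in which the subgroups $\{x: v_\lambda(x)\ge c\}$, $c\in\mathbb{R}$, form a basis of neighbourhoods of $0$, and put $\tau=\{\mathbf v\in\sigma:\lambda(\mathbf v)\le 0\}$. For a connected affine scheme $X$ and a geometric point $\overline{x}$ of $X$ (with values in an algebraically closed field), a finite étale cover $E\to X$ is called $p$-typical if the image of $\pi_1(X,\overline x)$ in the group of permutations of the fibre $E_{\overline x}$ is a $p$-group, and $\pi_1^p(X,\overline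 x)$ denotes the automorphism group of the fibre functor $E\mapsto E_{\overline x}$ on the category of $p$-typical covers of $X$, with its profinite topology. Then $\operatorname{Spec}R_{\sigma,\lambda}$ and $\operatorname{Spec}R_\tau$ are connected, and for every geometric point $\overline{y}$ of $\operatorname{Spec} R_{\sigma,\lambda}$, with image $\overline{x}$ in $\operatorname{Spec} R_\tau$, the natural map $$\pi_1^p(\operatorname{Spec}R_{\sigma,\lambda},\overline y)\to\pi_1^p(\operatorname{Spec}R_\tau,\overline x)$$ induced by $R_\tau\to R_\sigma\to R_{\sigma,\lambda}$ is an isomorphism of topological groups. -/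

import Mathlib

open CategoryTheory

universe u

noncomputable section

/-! ## `p`-typical covers of an affine scheme and the `p`-typical fundamental group

A finite étale cover of `Spec A` is affine, so the category of finite étale covers of `Spec A`
is the opposite of the category `CommAlgCat.FiniteEtale A` of finite étale `A`-algebras.  A
geometric point of `Spec A` is an algebra structure `A → Ω` on an algebraically closed field `Ω`,
and the fibre of the cover `Spec E` over it is the finite set of `A`-algebra maps `E → Ω`; this is
the fibre functor `CommAlgCat.FiniteEtale.fiber A Ω`. -/

section FundamentalGroup

variable (A : Type u) [CommRing A] (Ω : Type u) [Field Ω] [Algebra A Ω]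

/-- The fibre functor on finite étale covers of `Spec A` at the geometric point `Ω`. -/
abbrev etaleFibre : (CommAlgCat.FiniteEtale.{u} A)ᵒᵖ ⥤ FintypeCat.{u} :=
  CommAlgCat.FiniteEtale.fiber.{u} A Ω

/-- The étale fundamental group `π₁(Spec A, Ω)`: the automorphism group of the fibre functor,
with the profinite topology that Mathlib puts on it. -/
abbrev etalePi1 : Type _ := Aut (etaleFibre A Ω)

/-- The monodromy group of a finite étale cover `Spec E → Spec A`: the image of `π₁(Spec A, Ω)`
in the group of permutations of the fibre of the cover at `Ω`. -/
def monodromyGroup (E : CommAlgCat.FiniteEtale.{u} A) :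
    Subgroup (Equiv.Perm ((etaleFibre A Ω).obj (Opposite.op E))) :=
  (MulAction.toPermHom (etalePi1 A Ω) ((etaleFibre A Ω).obj (Opposite.op E))).range

/-- A finite étale cover is `p`-typical if its monodromy group is a `p`-group. -/
def isPTypical (p : ℕ) : ObjectProperty (CommAlgCat.FiniteEtale.{u} A) :=
  fun E => IsPGroup p (monodromyGroup A Ω E)

/-- The full subcategory of `p`-typical covers (as algebras). -/
abbrev PTypicalCover (p : ℕ) : Type _ := (isPTypical A Ω p).FullSubcategory

/-- The fibre functor on `p`-typical covers. -/
abbrev pTypicalFibre (p : ℕ) : (PTypicalCover A Ω p)ᵒᵖ ⥤ FintypeCat.{u} :=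
  (isPTypical A Ω p).ι.op ⋙ etaleFibre A Ω

/-- The `p`-typical fundamental group `π₁ᵖ(Spec A, Ω)`: the automorphism group of the fibre
functor on `p`-typical covers, with its profinite topology. -/
abbrev pTypicalPi1 (p : ℕ) : Type _ := Aut (pTypicalFibre A Ω p)

variable (B : Type u) [CommRing B] [Algebra A B] [Algebra B Ω] [IsScalarTower A B Ω]

/-- The natural map `π₁(Spec B, Ω) → π₁(Spec A, Ω)` for `A → B → Ω`: an automorphism of the fibre
functor of `B` acts on the fibre of an `A`-cover `E` through the identification of that fibre with
the fibre of the base change `B ⊗[A] E`. -/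
def etalePi1Map : etalePi1 B Ω →* etalePi1 A Ω :=
  ((CommAlgCat.FiniteEtale.fiberIsoBaseChangeFiber.{u} A Ω B).symm.conjAut.toMonoidHom).comp
    (((Functor.whiskeringLeft _ _ FintypeCat.{u}).obj
      (CommAlgCat.FiniteEtale.baseChange.{u} A B).op).mapAut (etaleFibre B Ω))

/-- The base change of a `p`-typical cover is `p`-typical. -/
theorem isPTypical_baseChange (p : ℕ) (E : CommAlgCat.FiniteEtale.{u} A)
    (hE : isPTypical A Ω p E) :
    isPTypical B Ω p ((CommAlgCat.FiniteEtale.baseChange.{u} A B).obj E) := by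
  rintro ⟨_, γ, rfl⟩
  obtain ⟨k, hk⟩ := hE ⟨_, etalePi1Map A Ω B γ, rfl⟩
  refine ⟨k, ?_⟩
  rw [Subtype.ext_iff] at hk ⊢
  simp only [SubmonoidClass.coe_pow, OneMemClass.coe_one, ← map_pow] at hk ⊢
  generalize γ ^ p ^ k = δ at hk ⊢
  ext x
  let i := (CommAlgCat.FiniteEtale.fiberIsoBaseChangeFiber.{u} A Ω B).app (Opposite.op E)
  have h1 := congrArg (fun f => i.hom (f (i.inv x))) hk
  have h2 : ∀ y, i.hom (i.inv y) = y := fun y => by simp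
  have h3 : i.hom (MulAction.toPermHom (etalePi1 A Ω) ((etaleFibre A Ω).obj (Opposite.op E))
      (etalePi1Map A Ω B δ) (i.inv x)) = i.hom (i.inv ((δ.hom.app _) (i.hom (i.inv x)))) := rfl
  rw [h2, h2] at h3
  exact h3.symm.trans (h1.trans (h2 x))

/-- Base change of `p`-typical covers along `A → B`. -/
def pTypicalBaseChange (p : ℕ) : PTypicalCover A Ω p ⥤ PTypicalCover B Ω p :=
  (isPTypical B Ω p).lift
    ((isPTypical A Ω p).ι ⋙ CommAlgCat.FiniteEtale.baseChange.{u} A B)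
    (fun E => isPTypical_baseChange A Ω B p E.obj E.property)

/-- The fibre of a `p`-typical `A`-cover is the fibre of its base change to `B`. -/
def pTypicalFibreIso (p : ℕ) :
    pTypicalFibre A Ω p ≅ (pTypicalBaseChange A Ω B p).op ⋙ pTypicalFibre B Ω p :=
  Functor.isoWhiskerLeft (isPTypical A Ω p).ι.op
    (CommAlgCat.FiniteEtale.fiberIsoBaseChangeFiber.{u} A Ω B)

/-- The natural map `π₁ᵖ(Spec B, Ω) → π₁ᵖ(Spec A, Ω)` induced by `Spec B → Spec A`. -/
def pTypicalPi1Map (p : ℕ) : pTypicalPi1 B Ω p →* pTypicalPi1 A Ω p :=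
  ((pTypicalFibreIso A Ω B p).symm.conjAut.toMonoidHom).comp
    (((Functor.whiskeringLeft _ _ FintypeCat.{u}).obj
      (pTypicalBaseChange A Ω B p).op).mapAut (pTypicalFibre B Ω p))

end FundamentalGroup

/-! ## Cone rings and their completions -/

section ConeRings

variable {n : ℕ}

/-- The monoid `σ ∩ ℤⁿ` of lattice points of a convex cone `σ ⊆ ℝⁿ`.  A convex cone is a nonempty
convex set closed under scaling by all `c ≥ 0`, that is, a `PointedCone`. -/
def latticePoints (σ : PointedCone ℝ (Fin n → ℝ)) : AddSubmonoid (Fin n → ℤ) where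
  carrier := {v | (fun i => (v i : ℝ)) ∈ σ}
  zero_mem' := by
    have : (fun i => (((0 : Fin n → ℤ) i : ℤ) : ℝ)) = 0 := by ext; simp
    simp only [Set.mem_ofPred_eq, this]
    exact σ.zero_mem
  add_mem' := by
    intro v w hv hw
    have : (fun i => (((v + w) i : ℤ) : ℝ)) = (fun i => (v i : ℝ)) + (fun i => (w i : ℝ)) := by
      ext; simp
    simp only [Set.mem_ofPred_eq, this]
    exact σ.add_mem hv hw

/-- The convex cone `τ = {v ∈ σ : l v ≤ 0}`. -/
def cutCone (σ : PointedCone ℝ (Fin n → ℝ)) (l : (Fin n → ℝ) →ₗ[ℝ] ℝ) :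
    PointedCone ℝ (Fin n → ℝ) where
  carrier := {v | v ∈ σ ∧ l v ≤ 0}
  zero_mem' := ⟨σ.zero_mem, by simp⟩
  add_mem' := fun {v w} hv hw => ⟨σ.add_mem hv.1 hw.1, by
    rw [map_add]; exact add_nonpos hv.2 hw.2⟩
  smul_mem' := fun c v hv => ⟨Submodule.smul_mem σ c hv.1, by
    have : l (c • v) = (c : ℝ) * l v := l.map_smul (c : ℝ) v
    rw [this]; exact mul_nonpos_of_nonneg_of_nonpos c.2 hv.2⟩

variable (R : Type u) [CommRing R]

/-- The monoid algebra `R_σ = R[σ ∩ ℤⁿ]`. -/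
abbrev ConeRing (σ : PointedCone ℝ (Fin n → ℝ)) : Type u :=
  AddMonoidAlgebra R (latticePoints σ)

/-- The natural inclusion `R_τ → R_σ` for `τ ⊆ σ`. -/
def coneRingInclusion {τ σ : PointedCone ℝ (Fin n → ℝ)} (h : τ ≤ σ) :
    ConeRing R τ →+* ConeRing R σ :=
  AddMonoidAlgebra.mapDomainRingHom R
    (AddSubmonoid.inclusion (S := latticePoints τ) (T := latticePoints σ) fun _ hv => h hv)

variable {R}

/-- The value of `l : ℝⁿ → ℝ` at a lattice point. -/
def latticeValue {σ : PointedCone ℝ (Fin n → ℝ)} (l : (Fin n → ℝ) →ₗ[ℝ] ℝ)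
    (v : latticePoints σ) : ℝ :=
  l (fun i => (v.1 i : ℝ))

theorem latticeValue_add {σ : PointedCone ℝ (Fin n → ℝ)} (l : (Fin n → ℝ) →ₗ[ℝ] ℝ)
    (v w : latticePoints σ) : latticeValue l (v + w) = latticeValue l v + latticeValue l w := by
  rw [latticeValue, latticeValue, latticeValue, ← map_add]
  congr 1
  ext i
  simp

/-- `v_l(∑ c_v [v]) = min {l v : c_v ≠ 0}`, which is `⊤` for the zero element. -/
def coneVal {σ : PointedCone ℝ (Fin n → ℝ)} (l : (Fin n → ℝ) →ₗ[ℝ] ℝ) (x : ConeRing R σ) :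
    WithTop ℝ :=
  x.coeff.support.inf fun v => (latticeValue l v : WithTop ℝ)

theorem le_coneVal_iff {σ : PointedCone ℝ (Fin n → ℝ)} (l : (Fin n → ℝ) →ₗ[ℝ] ℝ)
    (x : ConeRing R σ) (c : ℝ) :
    (c : WithTop ℝ) ≤ coneVal l x ↔ ∀ v, x.coeff v ≠ 0 → c ≤ latticeValue l v := by
  simp [coneVal, Finset.le_inf_iff]

/-- The additive subgroup `{x : c ≤ v_l(x)}` of `R_σ`. -/
def coneValGE (σ : PointedCone ℝ (Fin n → ℝ)) (l : (Fin n → ℝ) →ₗ[ℝ] ℝ) (c : ℝ) :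
    AddSubgroup (ConeRing R σ) where
  carrier := {x | (c : WithTop ℝ) ≤ coneVal l x}
  zero_mem' := by
    rw [Set.mem_ofPred_eq, le_coneVal_iff]; intro v hv; simp at hv
  add_mem' := by
    intro x y hx hy
    rw [Set.mem_ofPred_eq, le_coneVal_iff] at *
    intro v hv
    by_cases h : x.coeff v = 0
    · refine hy v fun h' => hv ?_
      simp [h, h']
    · exact hx v h
  neg_mem' := by
    intro x hx
    rw [Set.mem_ofPred_eq, le_coneVal_iff] at *
    intro v hv
    exact hx v fun h => hv (by simp [h])

theorem coneValGE_mul {σ : PointedCone ℝ (Fin n → ℝ)} (l : (Fin n → ℝ) →ₗ[ℝ] ℝ) {c d : ℝ}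
    {x y : ConeRing R σ} (hx : x ∈ coneValGE σ l c) (hy : y ∈ coneValGE σ l d) :
    x * y ∈ coneValGE σ l (c + d) := by
  classical
  refine (le_coneVal_iff l _ _).2 fun v hv => ?_
  have hx' := (le_coneVal_iff l x c).1 hx
  have hy' := (le_coneVal_iff l y d).1 hy
  have hv' := AddMonoidAlgebra.support_coeff_mul_subset x y (Finsupp.mem_support_iff.2 hv)
  obtain ⟨a, ha, b, hb, rfl⟩ := Finset.mem_add.1 hv'
  rw [latticeValue_add]
  exact add_le_add (hx' a (Finsupp.mem_support_iff.1 ha)) (hy' b (Finsupp.mem_support_iff.1 hb))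

theorem exists_mem_coneValGE {σ : PointedCone ℝ (Fin n → ℝ)} (l : (Fin n → ℝ) →ₗ[ℝ] ℝ)
    (x : ConeRing R σ) : ∃ c, x ∈ coneValGE σ l c := by
  obtain ⟨c, hc⟩ := (x.coeff.support.image (latticeValue l)).bddBelow
  refine ⟨c, (le_coneVal_iff l x c).2 fun v hv => hc ?_⟩
  exact Finset.mem_coe.2 (Finset.mem_image_of_mem _ (Finsupp.mem_support_iff.2 hv))

theorem coneValGE_basis (σ : PointedCone ℝ (Fin n → ℝ)) (l : (Fin n → ℝ) →ₗ[ℝ] ℝ) :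
    RingSubgroupsBasis (coneValGE (R := R) σ l) := by
  have mono : ∀ {c d : ℝ}, c ≤ d → coneValGE (R := R) σ l d ≤ coneValGE σ l c :=
    fun h x hx => le_trans (WithTop.coe_le_coe.2 h) hx
  refine RingSubgroupsBasis.of_comm _ ?_ ?_ ?_
  · exact fun c d => ⟨max c d, le_inf (mono (le_max_left _ _)) (mono (le_max_right _ _))⟩
  · intro c
    refine ⟨c / 2, ?_⟩
    rintro _ ⟨x, hx, y, hy, rfl⟩
    have := coneValGE_mul l hx hy
    rwa [add_halves] at this
  · intro x c
    obtain ⟨d, hd⟩ := exists_mem_coneValGE l x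
    refine ⟨c - d, fun y hy => ?_⟩
    have := coneValGE_mul l hd hy
    rwa [add_sub_cancel] at this

variable (R)

/-- The ring `R_σ`, regarded with the topology defined by `v_l`. -/
def ValuedConeRing (σ : PointedCone ℝ (Fin n → ℝ)) (_l : (Fin n → ℝ) →ₗ[ℝ] ℝ) : Type u :=
  ConeRing R σ

variable (σ : PointedCone ℝ (Fin n → ℝ)) (l : (Fin n → ℝ) →ₗ[ℝ] ℝ)

instance : CommRing (ValuedConeRing R σ l) := inferInstanceAs (CommRing (ConeRing R σ))

/-- The topology in which the sets `{x : c ≤ v_l(x)}`, `c ∈ ℝ`, form a basis of neighbourhoods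
of `0`. -/
instance : TopologicalSpace (ValuedConeRing R σ l) := (coneValGE_basis (R := R) σ l).topology

instance : IsTopologicalRing (ValuedConeRing R σ l) :=
  (coneValGE_basis (R := R) σ l).toRingFilterBasis.isTopologicalRing

instance : UniformSpace (ValuedConeRing R σ l) := IsTopologicalAddGroup.rightUniformSpace _

instance : IsUniformAddGroup (ValuedConeRing R σ l) := isUniformAddGroup_of_addCommGroup

/-- The completion `R_{σ,l}` of `R_σ` with respect to `v_l`. -/
abbrev ConeCompletion : Type u := UniformSpace.Completion (ValuedConeRing R σ l)

/-- The natural map `R_τ → R_σ → R_{σ,l}`, where `τ = {v ∈ σ : l v ≤ 0}`. -/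
def cutConeToCompletion : ConeRing R (cutCone σ l) →+* ConeCompletion R σ l :=
  (UniformSpace.Completion.coeRingHom (α := ValuedConeRing R σ l)).comp
    (coneRingInclusion R (τ := cutCone σ l) (σ := σ) fun _ hv => hv.1)

instance : Algebra (ConeRing R (cutCone σ l)) (ConeCompletion R σ l) :=
  (cutConeToCompletion R σ l).toAlgebra

end ConeRings

end

/-! Write A for R_τ and B for R_{σ,λ}. The monomials of R_σ with λ ≤ 0 span A and the others have
positive valuation, so every b in B is a + u with a in A and u of positive valuation, and A contains
no nonzero element of positive valuation. Since u^(p^k) tends to 0, the series w = ∑ u^(p^k)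
converges and u = w - w^p, while u^p = u forces u = 0. Hence x ↦ x^p - x is bijective on B/A. This
is `IsFrobeniusIso`, obtained in `isFrobeniusIso_coneCompletion` from
`IsFrobeniusIso.of_contracting`. It says that A and B have the same Artin–Schreier theory, and it is
the only fact about cones that the comparison of fundamental groups uses.

An idempotent solves x^p - x = 0, so connectedness passes from A to B; A itself is connected because
the support of an idempotent e = e^p is infinitely divisible by p.

Surjectivity of π₁ᵖ(B) → π₁ᵖ(A): if π₁(B) had a smaller image than π₁(A) in the monodromy p-group of
an A-cover, that image would lie in a normal subgroup of index p (`exists_character`). The resulting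
character of π₁(A) comes from an equation x^p - x = a (`exists_artinSchreier_of_character`, additive
Hilbert 90). Being trivial on π₁(B), it gives a root in B, hence in A, a contradiction. Compactness
of π₁(B) assembles the individual covers (`pTypicalPi1Map_surjective`).

Injectivity: a p-typical B-cover is trivialised by a tower of Artin–Schreier extensions. Each
equation can be modified by some c^p - c so that its constant comes from the A-side, and
`IsFrobeniusIso` passes to the next stage (`IsFrobeniusIso.artinSchreier`). So the cover is
dominated by the counterpart over B of a p-typical A-cover (`exists_tower_of_isPTypical`), and an
element acting trivially over A acts trivially over B.

The Galois theory behind this rests on `evalPoints_bijective`: over a connected splitting algebra D,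
the algebra D ⊗ E is canonically the functions on the D-points of E, so statements on finite étale
algebras become statements on finite sets and descend by faithful flatness. -/

section

open TensorProduct

/-! ### Connected spectra and idempotents -/

section ConnectedRing

theorem connectedSpace_primeSpectrum_iff {A : Type*} [CommRing A] :
    ConnectedSpace (PrimeSpectrum A) ↔
      Nontrivial A ∧ ∀ e : A, IsIdempotentElem e → e = 0 ∨ e = 1 := by
  rw [connectedSpace_iff_clopen, PrimeSpectrum.nonempty_iff_nontrivial]
  refine and_congr_right fun _ => ⟨fun h e he => ?_, fun h s hs => ?_⟩
  · rcases h _ (PrimeSpectrum.isClopen_iff.2 ⟨e, he, rfl⟩) with h | h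
    · left
      refine PrimeSpectrum.basicOpen_injOn_isIdempotentElem he IsIdempotentElem.zero ?_
      ext1; simp [h]
    · right
      refine PrimeSpectrum.basicOpen_injOn_isIdempotentElem he IsIdempotentElem.one ?_
      ext1; simp [h]
  · obtain ⟨e, he, rfl⟩ := PrimeSpectrum.isClopen_iff.1 hs
    rcases h e he with rfl | rfl <;> simp

theorem eq_zero_or_one_of_isIdempotentElem {A : Type*} [CommRing A]
    [ConnectedSpace (PrimeSpectrum A)] {e : A} (he : IsIdempotentElem e) : e = 0 ∨ e = 1 :=
  (connectedSpace_primeSpectrum_iff.1 ‹_›).2 e he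

theorem nontrivial_of_connectedSpace_primeSpectrum (A : Type*) [CommRing A]
    [ConnectedSpace (PrimeSpectrum A)] : Nontrivial A :=
  (connectedSpace_primeSpectrum_iff.1 ‹_›).1

instance (K : Type*) [Field K] : ConnectedSpace (PrimeSpectrum K) :=
  connectedSpace_primeSpectrum_iff.2 ⟨inferInstance, fun _ he => IsIdempotentElem.iff_eq_zero_or_one.1 he⟩

/-- A homomorphism from a split algebra to a connected one is an evaluation. -/
theorem algHom_exists_eq_eval_of_connected {ι D C : Type*} [Finite ι] [CommRing D] [CommRing C]
    [Algebra D C] [ConnectedSpace (PrimeSpectrum C)] (x : (ι → D) →ₐ[D] C) :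
    ∃ i, ∀ f, x f = algebraMap D C (f i) := by
  classical
  have := Fintype.ofFinite ι
  have := nontrivial_of_connectedSpace_primeSpectrum C
  have hid : ∀ i, x (Pi.single i 1) = 0 ∨ x (Pi.single i 1) = 1 := fun i =>
    eq_zero_or_one_of_isIdempotentElem (by
      rw [IsIdempotentElem, ← map_mul, ← Pi.single_mul, one_mul])
  have h1 : ∑ i, x (Pi.single i 1) = 1 := by
    rw [← map_sum, ← map_one x]
    congr 1
    exact Finset.univ_sum_single (1 : ι → D)
  obtain ⟨i, hi⟩ : ∃ i, x (Pi.single i 1) = 1 := by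
    by_contra! h
    rw [Finset.sum_eq_zero fun i _ => (hid i).resolve_right (h i)] at h1
    exact zero_ne_one h1
  refine ⟨i, fun f => ?_⟩
  have h2 : f * Pi.single i 1 = f i • Pi.single i 1 := by
    ext j
    by_cases h : j = i
    · subst h; simp
    · simp [h]
  rw [← mul_one (x f), ← hi, ← map_mul, h2, map_smul, hi, Algebra.smul_def, mul_one]

end ConnectedRing

/-! ### Splitting finite étale algebras over a connected base -/

section FiniteEtaleAlgebra

theorem exists_rankAtStalk_eq_of_connected (A E : Type*) [CommRing A] [CommRing E] [Algebra A E]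
    [ConnectedSpace (PrimeSpectrum A)] [Module.Finite A E] [Algebra.Etale A E] :
    ∃ n : ℕ, Module.rankAtStalk (R := A) E = n := by
  have := Module.FinitePresentation.of_finite_of_finitePresentation A E
  have h := Module.isLocallyConstant_rankAtStalk (R := A) (M := E)
  obtain ⟨n, hn⟩ := h.exists_eq_const
  exact ⟨n, hn⟩

/-- The rank is constant on a connected base. It is nonzero when E is, so every prime lies in the
image of Spec E. -/
theorem faithfullyFlat_of_connected (A E : Type*) [CommRing A] [CommRing E] [Algebra A E]
    [ConnectedSpace (PrimeSpectrum A)] [Module.Finite A E] [Algebra.Etale A E] [Nontrivial E] :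
    Module.FaithfullyFlat A E := by
  obtain ⟨n, hn⟩ := exists_rankAtStalk_eq_of_connected A E
  apply Module.FaithfullyFlat.of_comap_surjective
  rw [← PrimeSpectrum.rankAtStalk_pos_iff_comap_surjective]
  intro p
  rw [hn]
  refine Nat.pos_of_ne_zero fun h0 => ?_
  simp only [Nat.cast_id, Pi.natCast_apply] at h0
  subst h0
  rw [Nat.cast_zero, Module.rankAtStalk_eq_zero_iff_subsingleton] at hn
  exact not_subsingleton E hn

theorem nonempty_algHom_of_faithfullyFlat (A E Ω : Type*) [CommRing A] [CommRing E] [Algebra A E]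
    [Module.Finite A E] [Algebra.Etale A E] [Module.FaithfullyFlat A E]
    [Field Ω] [IsAlgClosed Ω] [Algebra A Ω] : Nonempty (E →ₐ[A] Ω) := by
  have : Nontrivial (Ω ⊗[A] E) := inferInstance
  obtain ⟨n, ⟨e⟩⟩ := Algebra.IsFiniteSplit.nonempty_algEquiv_fun Ω (Ω ⊗[A] E)
  have : Nontrivial (Fin n → Ω) := e.toEquiv.symm.nontrivial
  have : Nonempty (Fin n) := by
    by_contra h
    rw [not_nonempty_iff] at h
    exact not_subsingleton (Fin n → Ω) inferInstance
  exact ⟨(((Pi.evalAlgHom Ω (fun _ : Fin n => Ω) (Classical.arbitrary _)).comp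
    e.toAlgHom).restrictScalars A).comp Algebra.TensorProduct.includeRight⟩

theorem etale_quotient_span_isIdempotentElem (A : Type*) {E : Type*} [CommRing A] [CommRing E]
    [Algebra A E] [Algebra.Etale A E] {e : E} (he : IsIdempotentElem e) :
    Algebra.Etale A (E ⧸ Ideal.span {e}) := by
  have h := IsLocalization.Away.quotient_of_isIdempotentElem he.one_sub
  rw [sub_sub_cancel] at h
  have := Algebra.Etale.of_isLocalizationAway (A := E ⧸ Ideal.span {e}) (1 - e)
  exact Algebra.Etale.comp A E _

/-- Induction on the rank: a nontrivial idempotent splits T into two nonzero factors, each of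
smaller rank. -/
theorem exists_connected_algHom (A T : Type u) [CommRing A] [ConnectedSpace (PrimeSpectrum A)]
    [CommRing T] [Algebra A T] [Nontrivial T] [Module.Finite A T] [Algebra.Etale A T] :
    ∃ (D : Type u) (_ : CommRing D) (_ : Algebra A D) (_ : Module.Finite A D)
      (_ : Algebra.Etale A D) (_ : T →ₐ[A] D), ConnectedSpace (PrimeSpectrum D) := by
  obtain ⟨n, hn⟩ := exists_rankAtStalk_eq_of_connected A T
  induction n using Nat.strong_induction_on generalizing T with
  | _ n ih =>
  by_cases hc : ConnectedSpace (PrimeSpectrum T)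
  · exact ⟨T, inferInstance, inferInstance, inferInstance, inferInstance, AlgHom.id A T, hc⟩
  rw [connectedSpace_primeSpectrum_iff] at hc
  push Not at hc
  obtain ⟨e, he, h0, h1⟩ := hc inferInstance
  have nt : ∀ {f : T}, IsIdempotentElem f → f ≠ 1 → Nontrivial (T ⧸ Ideal.span {f}) := by
    intro f hf hf1
    rw [Ideal.Quotient.nontrivial_iff, Ne, Ideal.span_singleton_eq_top]
    intro hu
    exact hf1 (by simpa using hu.mul_left_cancel (hf.eq.trans (mul_one f).symm))
  have := nt he h1
  have := nt he.one_sub (by simpa using h0)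
  have := etale_quotient_span_isIdempotentElem A he
  have := etale_quotient_span_isIdempotentElem A he.one_sub
  obtain ⟨n₁, hn₁⟩ := exists_rankAtStalk_eq_of_connected A (T ⧸ Ideal.span {e})
  obtain ⟨n₂, hn₂⟩ := exists_rankAtStalk_eq_of_connected A (T ⧸ Ideal.span {1 - e})
  have hpos : n₂ ≠ 0 := by
    rintro rfl
    rw [Nat.cast_zero, Module.rankAtStalk_eq_zero_iff_subsingleton] at hn₂
    exact not_subsingleton _ hn₂
  have hsum : n = n₁ + n₂ := by
    rw [Module.rankAtStalk_eq_of_equiv (AlgEquiv.prodQuotientOfIsIdempotentElem A he he.one_sub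
      (by simp) (by simp [mul_sub, he.eq])).toLinearEquiv, Module.rankAtStalk_prod, hn₁, hn₂] at hn
    have := nontrivial_of_connectedSpace_primeSpectrum A
    have := congrFun hn (Classical.arbitrary _)
    simpa using this.symm
  obtain ⟨D, i1, i2, i3, i4, φ, hD⟩ := ih n₁ (by omega) (T ⧸ Ideal.span {e}) hn₁
  exact ⟨D, i1, i2, i3, i4, φ.comp (Ideal.Quotient.mkₐ A _), hD⟩

/-- A finite étale algebra over a connected ring is split by a connected finite étale algebra. -/
theorem exists_connected_isFiniteSplit (A E : Type u) [CommRing A]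
    [ConnectedSpace (PrimeSpectrum A)]
    [CommRing E] [Algebra A E] [Module.Finite A E] [Algebra.Etale A E] :
    ∃ (D : Type u) (_ : CommRing D) (_ : Algebra A D) (_ : Module.Finite A D)
      (_ : Algebra.Etale A D), ConnectedSpace (PrimeSpectrum D) ∧
        Algebra.IsFiniteSplit D (D ⊗[A] E) := by
  obtain ⟨n, hn⟩ := exists_rankAtStalk_eq_of_connected A E
  obtain ⟨T, _, _, _, _, _, hT⟩ := Algebra.IsFiniteSplit.exists_tensorProduct_of_etale hn
  have := nontrivial_of_connectedSpace_primeSpectrum A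
  have : Nontrivial T := (FaithfulSMul.algebraMap_injective A T).nontrivial
  obtain ⟨D, _, _, _, _, φ, hD⟩ := exists_connected_algHom A T
  refine ⟨D, inferInstance, inferInstance, inferInstance, inferInstance, hD, ?_⟩
  algebraize [φ.toRingHom]
  have : IsScalarTower A T D := .of_algebraMap_eq' φ.comp_algebraMap.symm
  exact .of_algEquiv (Algebra.TensorProduct.cancelBaseChange A T D D E)

theorem exists_connected_isFiniteSplit_pair (A E E' : Type u) [CommRing A]
    [ConnectedSpace (PrimeSpectrum A)]
    [CommRing E] [Algebra A E] [Module.Finite A E] [Algebra.Etale A E]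
    [CommRing E'] [Algebra A E'] [Module.Finite A E'] [Algebra.Etale A E'] :
    ∃ (D : Type u) (_ : CommRing D) (_ : Algebra A D) (_ : Module.Finite A D)
      (_ : Algebra.Etale A D), ConnectedSpace (PrimeSpectrum D) ∧
        Algebra.IsFiniteSplit D (D ⊗[A] E) ∧ Algebra.IsFiniteSplit D (D ⊗[A] E') := by
  obtain ⟨T, _, _, _, _, hT, hTE⟩ := exists_connected_isFiniteSplit A E
  obtain ⟨D, _, _, _, _, hD, hDE⟩ := exists_connected_isFiniteSplit T (T ⊗[A] E')
  algebraize [(algebraMap T D).comp (algebraMap A T)]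
  have := Module.Finite.trans (R := A) T D
  have := Algebra.Etale.comp A T D
  refine ⟨D, inferInstance, inferInstance, inferInstance, inferInstance, hD, ?_, ?_⟩
  · exact .of_algEquiv (Algebra.TensorProduct.cancelBaseChange A T D D E)
  · exact .of_algEquiv (Algebra.TensorProduct.cancelBaseChange A T D D E')

/-- The evaluation of `D ⊗ E` at all `D`-valued points of `E`. -/
def evalPoints (A D E : Type*) [CommRing A] [CommRing D] [Algebra A D] [CommRing E] [Algebra A E] :
    D ⊗[A] E →ₐ[D] ((E →ₐ[A] D) → D) :=
  AlgHom.pi fun x => Algebra.TensorProduct.lift (AlgHom.id D D) x fun _ _ => Commute.all _ _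

theorem evalPoints_tmul {A D E : Type*} [CommRing A] [CommRing D] [Algebra A D] [CommRing E]
    [Algebra A E] (d : D) (e : E) (x : E →ₐ[A] D) : evalPoints A D E (d ⊗ₜ e) x = d * x e := by
  simp [evalPoints]

theorem evalPoints_map {A D E E' : Type*} [CommRing A] [CommRing D] [Algebra A D] [CommRing E]
    [Algebra A E] [CommRing E'] [Algebra A E'] (f : E →ₐ[A] E') (u : D ⊗[A] E) (x : E' →ₐ[A] D) :
    evalPoints A D E' (Algebra.TensorProduct.map (AlgHom.id D D) f u) x =
      evalPoints A D E u (x.comp f) := by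
  induction u with
  | zero => simp
  | tmul d e => simp [evalPoints_tmul]
  | add u v hu hv => simp [hu, hv]

section Split

variable (A D E : Type*) [CommRing A] [CommRing D] [Algebra A D] [CommRing E] [Algebra A E]
  [Algebra.IsFiniteSplit D (D ⊗[A] E)]

/-- Each coordinate of a splitting is a D-point, and since D has only trivial idempotents every
D-point is a coordinate. The index set of the splitting is therefore intrinsic. -/
theorem exists_points_equiv_of_isFiniteSplit [ConnectedSpace (PrimeSpectrum D)] :
    ∃ (n : ℕ) (θ : D ⊗[A] E ≃ₐ[D] (Fin n → D)) (s : Fin n ≃ (E →ₐ[A] D)),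
      ∀ u i, evalPoints A D E u (s i) = θ u i := by
  obtain ⟨n, ⟨θ⟩⟩ := Algebra.IsFiniteSplit.nonempty_algEquiv_fun D (D ⊗[A] E)
  have := nontrivial_of_connectedSpace_primeSpectrum D
  let s : Fin n → (E →ₐ[A] D) := fun i => ((Pi.evalAlgHom A (fun _ => D) i).comp
    (θ.toAlgHom.restrictScalars A)).comp Algebra.TensorProduct.includeRight
  have hs : ∀ u i, evalPoints A D E u (s i) = θ u i := by
    intro u i
    induction u with
    | zero => simp
    | tmul d e =>
      have h : d ⊗ₜ[A] e = d • (1 ⊗ₜ[A] e) := by rw [TensorProduct.smul_tmul', smul_eq_mul, mul_one]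
      rw [evalPoints_tmul, h, map_smul]
      simp [s]
    | add u v hu hv => simp [hu, hv]
  refine ⟨n, θ, Equiv.ofBijective s ⟨fun i j hij => ?_, fun x => ?_⟩, hs⟩
  -- The idempotent of the i-th factor separates the coordinates i and j.
  · by_contra h
    have h1 := hs (θ.symm (Pi.single i 1)) i
    rw [hij, hs] at h1
    simp [Pi.single_eq_of_ne (Ne.symm h)] at h1
  · obtain ⟨i, hi⟩ := algHom_exists_eq_eval_of_connected
      ((Algebra.TensorProduct.lift (AlgHom.id D D) x fun _ _ => Commute.all _ _).comp
        θ.symm.toAlgHom)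
    refine ⟨i, ?_⟩
    ext e
    have := hi (θ (1 ⊗ₜ e))
    simpa [s] using this.symm

theorem evalPoints_bijective [ConnectedSpace (PrimeSpectrum D)] :
    Function.Bijective (evalPoints A D E) := by
  obtain ⟨n, θ, s, hs⟩ := exists_points_equiv_of_isFiniteSplit A D E
  have : ⇑(evalPoints A D E) = (Equiv.arrowCongr s (Equiv.refl D)) ∘ θ := by
    ext u x
    obtain ⟨i, rfl⟩ := s.surjective x
    simp [hs]
  rw [this]
  exact (Equiv.bijective _).comp θ.bijective

theorem finite_points_of_isFiniteSplit [ConnectedSpace (PrimeSpectrum D)] :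
    Finite (E →ₐ[A] D) := by
  obtain ⟨n, θ, s, hs⟩ := exists_points_equiv_of_isFiniteSplit A D E
  exact Finite.of_equiv _ s

/-- Over a split algebra a point with connected target is the choice of a factor, and this choice
does not depend on the target. For C an algebraically closed field, geometric points become
D-points. -/
theorem points_comp_bijective [ConnectedSpace (PrimeSpectrum D)] {C : Type*} [CommRing C]
    [Algebra A C] [ConnectedSpace (PrimeSpectrum C)] (d : D →ₐ[A] C) :
    Function.Bijective fun x : E →ₐ[A] D => d.comp x := by
  algebraize [d.toRingHom]
  have := nontrivial_of_connectedSpace_primeSpectrum C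
  have : IsScalarTower A D C := .of_algebraMap_eq' d.comp_algebraMap.symm
  have hfin := finite_points_of_isFiniteSplit A D E
  have hb := evalPoints_bijective A D E
  classical
  refine ⟨fun x y hxy => ?_, fun y => ?_⟩
  · by_contra h
    have h1 : ∀ (z : E →ₐ[A] D) (u : D ⊗[A] E), d (evalPoints A D E u z) =
        Algebra.TensorProduct.lift (Algebra.ofId D C) (d.comp z) (fun _ _ => Commute.all _ _) u := by
      intro z u
      induction u with
      | zero => simp
      | tmul a e => simp [evalPoints_tmul, Algebra.ofId_apply]; rfl
      | add u v hu hv => simp [← hu, ← hv]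
    obtain ⟨u, hu⟩ := hb.2 (Pi.single x 1)
    have h2 := h1 x u
    have hxy' : d.comp x = d.comp y := hxy
    rw [hxy', ← h1 y, hu] at h2
    simp [Pi.single_eq_of_ne (Ne.symm h)] at h2
  · obtain ⟨x, hx⟩ := algHom_exists_eq_eval_of_connected
      ((Algebra.TensorProduct.lift (Algebra.ofId D C) y fun _ _ => Commute.all _ _).comp
        (AlgEquiv.ofBijective _ hb).symm.toAlgHom)
    refine ⟨x, ?_⟩
    ext e
    have h := hx (evalPoints A D E (1 ⊗ₜ e))
    have h3 : (AlgEquiv.ofBijective _ hb).symm (evalPoints A D E (1 ⊗ₜ e)) = 1 ⊗ₜ e :=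
      (AlgEquiv.symm_apply_eq _).2 rfl
    rw [AlgHom.comp_apply] at h
    erw [h3] at h
    rw [evalPoints_tmul, one_mul, Algebra.TensorProduct.lift_tmul, map_one, one_mul] at h
    exact h.symm

end Split

end FiniteEtaleAlgebra

end

/-! ### Homomorphisms of finite étale algebras read on points -/

section

open TensorProduct

section PointsMap

variable {A : Type u} [CommRing A] {E E' : Type u} [CommRing E] [Algebra A E]
  [CommRing E'] [Algebra A E']

theorem tensorProduct_map_injective_iff (D : Type*) [CommRing D] [Algebra A D]
    [Module.FaithfullyFlat A D] (f : E →ₐ[A] E') :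
    Function.Injective (Algebra.TensorProduct.map (AlgHom.id D D) f) ↔ Function.Injective f :=
  Module.FaithfullyFlat.lTensor_injective_iff_injective A D f.toLinearMap

theorem tensorProduct_map_surjective_iff (D : Type*) [CommRing D] [Algebra A D]
    [Module.FaithfullyFlat A D] (f : E →ₐ[A] E') :
    Function.Surjective (Algebra.TensorProduct.map (AlgHom.id D D) f) ↔ Function.Surjective f :=
  Module.FaithfullyFlat.lTensor_surjective_iff_surjective A D f.toLinearMap

theorem evalPoints_comp_map (D : Type*) [CommRing D] [Algebra A D] (f : E →ₐ[A] E') :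
    evalPoints A D E' ∘ Algebra.TensorProduct.map (AlgHom.id D D) f =
      (fun c x => c (x.comp f)) ∘ evalPoints A D E :=
  funext fun u => funext fun x => evalPoints_map f u x

/-- Precomposition on points commutes with composing with `d`. -/
theorem points_comp_comm {D : Type u} [CommRing D] [Algebra A D] {Ω : Type u} [CommRing Ω]
    [Algebra A Ω] (d : D →ₐ[A] Ω) (f : E →ₐ[A] E') :
    (fun x : E' →ₐ[A] Ω => x.comp f) ∘ (fun x : E' →ₐ[A] D => d.comp x) =
      (fun x : E →ₐ[A] D => d.comp x) ∘ fun x : E' →ₐ[A] D => x.comp f := rfl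

/-- Flat base change commutes with equalizers, and over D the equalizer consists of the functions on
the points of E that are constant along the relation z ∘ f ~ z ∘ g. It is thus the algebra of
functions on the quotient set. -/
theorem isFiniteSplit_equalizer (f g : E →ₐ[A] E') (D : Type*) [CommRing D] [Algebra A D]
    [Module.FaithfullyFlat A D]
    [ConnectedSpace (PrimeSpectrum D)]
    [Algebra.IsFiniteSplit D (D ⊗[A] E)] [Algebra.IsFiniteSplit D (D ⊗[A] E')] :
    Algebra.IsFiniteSplit D (D ⊗[A] AlgHom.equalizer f g) := by
  let r : (E →ₐ[A] D) → (E →ₐ[A] D) → Prop := fun x y => ∃ z : E' →ₐ[A] D, x = z.comp f ∧ y = z.comp g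
  have := finite_points_of_isFiniteSplit A D E
  let ψ : (Quot r → D) →ₐ[D] D ⊗[A] E :=
    (AlgEquiv.ofBijective _ (evalPoints_bijective A D E)).symm.toAlgHom.comp
      (AlgHom.pi fun x => Pi.evalAlgHom D (fun _ => D) (Quot.mk r x))
  have hψ : ∀ c x, evalPoints A D E (ψ c) x = c (Quot.mk r x) := fun c x =>
    congrFun ((AlgEquiv.ofBijective _ (evalPoints_bijective A D E)).apply_symm_apply _) x
  have hmem : ∀ c, ψ c ∈ AlgHom.equalizer (Algebra.TensorProduct.map (AlgHom.id D D) f)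
      (Algebra.TensorProduct.map (AlgHom.id D D) g) := by
    intro c
    rw [AlgHom.mem_equalizer]
    apply (evalPoints_bijective A D E').1
    ext z
    rw [evalPoints_map, evalPoints_map, hψ, hψ]
    exact congrArg c (Quot.sound ⟨z, rfl, rfl⟩)
  refine .of_algEquiv ((AlgEquiv.ofBijective (ψ.codRestrict _ hmem) ⟨?_, ?_⟩).trans
    (AlgHom.tensorEqualizerEquiv D D f g).symm)
  · intro c c' h
    have h' : ψ c = ψ c' := congrArg Subtype.val h
    ext q
    obtain ⟨x, rfl⟩ := Quot.mk_surjective q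
    rw [← hψ c, ← hψ c', h']
  · rintro ⟨w, hw⟩
    refine ⟨Quot.lift (evalPoints A D E w) ?_, Subtype.ext ?_⟩
    · rintro _ _ ⟨z, rfl, rfl⟩
      rw [← evalPoints_map, ← evalPoints_map]
      exact congrArg (evalPoints A D E' · z) hw
    · apply (evalPoints_bijective A D E).1
      ext x
      exact hψ _ x

end PointsMap

section FibreCriteria

variable {A : Type u} [CommRing A] [ConnectedSpace (PrimeSpectrum A)]
  {E E' : Type u} [CommRing E] [Algebra A E] [Module.Finite A E] [Algebra.Etale A E]
  [CommRing E'] [Algebra A E'] [Module.Finite A E'] [Algebra.Etale A E']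
  (Ω : Type u) [Field Ω] [IsAlgClosed Ω] [Algebra A Ω]

variable (A E E') in
theorem exists_splitting_pair :
    ∃ (D : Type u) (_ : CommRing D) (_ : Algebra A D) (_ : D →ₐ[A] Ω),
      ConnectedSpace (PrimeSpectrum D) ∧ Module.FaithfullyFlat A D ∧
        Algebra.IsFiniteSplit D (D ⊗[A] E) ∧ Algebra.IsFiniteSplit D (D ⊗[A] E') := by
  obtain ⟨D, _, _, _, _, hD, h1, h2⟩ := exists_connected_isFiniteSplit_pair A E E'
  have := nontrivial_of_connectedSpace_primeSpectrum D
  have := faithfullyFlat_of_connected A D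
  obtain ⟨d⟩ := nonempty_algHom_of_faithfullyFlat A D Ω
  exact ⟨D, inferInstance, inferInstance, d, hD, this, h1, h2⟩

variable (A E) in
theorem finite_points : Finite (E →ₐ[A] Ω) := by
  obtain ⟨D, _, _, d, _, _, _, _⟩ := exists_splitting_pair A E E Ω
  have := finite_points_of_isFiniteSplit A D E
  exact Finite.of_surjective _ (points_comp_bijective A D E d).2

/-- Over D the map f is composition of functions with a map of point sets; functions extend along an
injective map of sets, and surjectivity descends. -/
theorem surjective_of_points_injective (f : E →ₐ[A] E')
    (hf : Function.Injective fun x : E' →ₐ[A] Ω => x.comp f) : Function.Surjective f := by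
  obtain ⟨D, _, _, d, _, _, _, _⟩ := exists_splitting_pair A E E' Ω
  have := nontrivial_of_connectedSpace_primeSpectrum D
  have hα : Function.Injective fun x : E' →ₐ[A] D => x.comp f := by
    rw [← Function.Injective.of_comp_iff (points_comp_bijective A D E d).1, ← points_comp_comm]
    exact hf.comp (points_comp_bijective A D E' d).1
  rw [← tensorProduct_map_surjective_iff D,
    ← Function.Surjective.of_comp_iff' (evalPoints_bijective A D E'), evalPoints_comp_map]
  exact hα.surjective_comp_right.comp (evalPoints_bijective A D E).2

theorem injective_iff_points_surjective (f : E →ₐ[A] E') :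
    Function.Injective f ↔ Function.Surjective fun x : E' →ₐ[A] Ω => x.comp f := by
  obtain ⟨D, _, _, d, _, _, _, _⟩ := exists_splitting_pair A E E' Ω
  have := nontrivial_of_connectedSpace_primeSpectrum D
  rw [← Function.Surjective.of_comp_iff (fun x : E' →ₐ[A] Ω => x.comp f)
    (points_comp_bijective A D E' d).2, points_comp_comm,
    Function.Surjective.of_comp_iff' (points_comp_bijective A D E d),
    ← Function.injective_comp_right_iff_surjective (γ := D), ← tensorProduct_map_injective_iff D,
    ← Function.Injective.of_comp_iff (evalPoints_bijective A D E').1, evalPoints_comp_map,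
    Function.Injective.of_comp_iff' _ (evalPoints_bijective A D E)]
  rfl

theorem bijective_of_points_bijective (f : E →ₐ[A] E')
    (hf : Function.Bijective fun x : E' →ₐ[A] Ω => x.comp f) : Function.Bijective f :=
  ⟨(injective_iff_points_surjective Ω f).2 hf.2, surjective_of_points_injective Ω f hf.1⟩

variable (f g : E →ₐ[A] E')

theorem etale_equalizer :
    Module.Finite A (AlgHom.equalizer f g) ∧ Algebra.Etale A (AlgHom.equalizer f g) := by
  obtain ⟨D, _, _, _, _, hD, h1, h2⟩ := exists_connected_isFiniteSplit_pair A E E'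
  have := nontrivial_of_connectedSpace_primeSpectrum D
  have := faithfullyFlat_of_connected A D
  have := isFiniteSplit_equalizer f g D
  have : Module.FinitePresentation D (D ⊗[A] AlgHom.equalizer f g) := inferInstance
  exact ⟨Module.Finite.of_finite_tensorProduct_of_faithfullyFlat D,
    Algebra.Etale.of_etale_tensorProduct_of_faithfullyFlat D⟩

variable {Ω}

theorem exists_extension_of_equalizer (y : AlgHom.equalizer f g →ₐ[A] Ω) :
    ∃ x : E →ₐ[A] Ω, x.comp (AlgHom.equalizer f g).val = y := by
  obtain ⟨_, _⟩ := etale_equalizer f g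
  exact (injective_iff_points_surjective Ω (AlgHom.equalizer f g).val).1 Subtype.val_injective y

/-- The indicator function of a fibre of t is invariant, so over D it lies in the equalizer, where
it would separate x from x' if t did. With `exists_extension_of_equalizer` this says that the points
of the equalizer are the coequalizer of the point sets. -/
theorem eq_of_eq_on_equalizer {x x' : E →ₐ[A] Ω}
    (h : x.comp (AlgHom.equalizer f g).val = x'.comp (AlgHom.equalizer f g).val)
    {T : Type*} (t : (E →ₐ[A] Ω) → T) (ht : ∀ z : E' →ₐ[A] Ω, t (z.comp f) = t (z.comp g)) :
    t x = t x' := by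
  classical
  obtain ⟨D, _, _, d, _, _, _, _⟩ := exists_splitting_pair A E E' Ω
  have hb := evalPoints_bijective A D E
  obtain ⟨w, hw⟩ := hb.2 fun z => if t (d.comp z) = t x then 1 else 0
  have hmem : w ∈ AlgHom.equalizer (Algebra.TensorProduct.map (AlgHom.id D D) f)
      (Algebra.TensorProduct.map (AlgHom.id D D) g) := by
    rw [AlgHom.mem_equalizer]
    apply (evalPoints_bijective A D E').1
    ext z
    rw [evalPoints_map, evalPoints_map, hw]
    simp only [← AlgHom.comp_assoc, ht]
    congr
  obtain ⟨v, hv⟩ := (AlgHom.tensorEqualizerEquiv D D f g).surjective ⟨w, hmem⟩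
  have hv' : Algebra.TensorProduct.map (AlgHom.id D D) (AlgHom.equalizer f g).val v = w := by
    rw [← AlgHom.coe_tensorEqualizer, ← AlgHom.tensorEqualizerEquiv_apply, hv]
  obtain ⟨z, rfl⟩ := (points_comp_bijective A D E d).2 x
  obtain ⟨z', rfl⟩ := (points_comp_bijective A D E d).2 x'
  have hzz : z.comp (AlgHom.equalizer f g).val = z'.comp (AlgHom.equalizer f g).val := by
    have := isFiniteSplit_equalizer f g D
    exact (points_comp_bijective A D (AlgHom.equalizer f g) d).1 h
  have h1 : evalPoints A D E w z = evalPoints A D E w z' := by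
    rw [← hv', evalPoints_map, evalPoints_map, hzz]
  have := nontrivial_of_connectedSpace_primeSpectrum D
  rw [hw] at h1
  by_contra hne
  simp [Ne.symm hne] at h1

end FibreCriteria

end

/-! ### The Galois category of finite étale covers -/

section

open TensorProduct Limits Opposite

namespace EtaleCover

section Pushout

/-- The algebra is E₁ ⊗ E₂ over E₀. Its universal property is stated for arbitrary targets T, so
that the case of covers gives pullbacks and the case T = Ω gives their preservation by the fibre
functor. -/
theorem exists_pushout {A E₀ E₁ E₂ : Type u} [CommRing A] [CommRing E₀] [CommRing E₁] [CommRing E₂]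
    [Algebra A E₀] [Algebra A E₁] [Algebra A E₂] [Module.Finite A E₀] [Module.Finite A E₁]
    [Module.Finite A E₂] [Algebra.Etale A E₀] [Algebra.Etale A E₁] [Algebra.Etale A E₂]
    (f₁ : E₀ →ₐ[A] E₁) (f₂ : E₀ →ₐ[A] E₂) :
    ∃ (P : Type u) (_ : CommRing P) (_ : Algebra A P) (_ : Module.Finite A P)
      (_ : Algebra.Etale A P) (i₁ : E₁ →ₐ[A] P) (i₂ : E₂ →ₐ[A] P), i₁.comp f₁ = i₂.comp f₂ ∧
      (∀ (T : Type u) [CommRing T] [Algebra A T] (x₁ : E₁ →ₐ[A] T) (x₂ : E₂ →ₐ[A] T),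
        x₁.comp f₁ = x₂.comp f₂ → ∃ x : P →ₐ[A] T, x.comp i₁ = x₁ ∧ x.comp i₂ = x₂) ∧
      ∀ (T : Type u) [CommRing T] [Algebra A T] (x y : P →ₐ[A] T),
        x.comp i₁ = y.comp i₁ → x.comp i₂ = y.comp i₂ → x = y := by
  algebraize [f₁.toRingHom, f₂.toRingHom]
  have : IsScalarTower A E₀ E₁ := .of_algebraMap_eq' f₁.comp_algebraMap.symm
  have : IsScalarTower A E₀ E₂ := .of_algebraMap_eq' f₂.comp_algebraMap.symm
  have : Algebra.Etale E₀ E₁ := Algebra.Etale.of_restrictScalars A _ _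
  have : Algebra.Etale E₀ E₂ := Algebra.Etale.of_restrictScalars A _ _
  have : Module.Finite E₀ E₁ := Module.Finite.of_restrictScalars_finite A E₀ E₁
  have : Module.Finite E₀ E₂ := Module.Finite.of_restrictScalars_finite A E₀ E₂
  have : Module.Finite A (E₁ ⊗[E₀] E₂) := Module.Finite.trans E₁ _
  have : Algebra.Etale A (E₁ ⊗[E₀] E₂) := Algebra.Etale.comp A E₁ _
  let i₁ : E₁ →ₐ[A] E₁ ⊗[E₀] E₂ := Algebra.TensorProduct.includeLeft
  let i₂ : E₂ →ₐ[A] E₁ ⊗[E₀] E₂ := Algebra.TensorProduct.includeRight.restrictScalars A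
  refine ⟨E₁ ⊗[E₀] E₂, inferInstance, inferInstance, inferInstance, inferInstance, i₁, i₂, ?_, ?_, ?_⟩
  · ext e
    change (algebraMap E₀ E₁ e) ⊗ₜ[E₀] (1 : E₂) = 1 ⊗ₜ algebraMap E₀ E₂ e
    rw [Algebra.algebraMap_eq_smul_one, Algebra.algebraMap_eq_smul_one, TensorProduct.smul_tmul]
  · intro T _ _ x₁ x₂ h
    algebraize [(x₁.comp f₁).toRingHom]
    have : IsScalarTower A E₀ T := .of_algebraMap_eq' (x₁.comp f₁).comp_algebraMap.symm
    let y₁ : E₁ →ₐ[E₀] T := { x₁ with commutes' := fun e => rfl }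
    let y₂ : E₂ →ₐ[E₀] T := { x₂ with commutes' := fun e => (DFunLike.congr_fun h e).symm }
    refine ⟨(Algebra.TensorProduct.lift y₁ y₂ fun _ _ => Commute.all _ _).restrictScalars A, ?_, ?_⟩
    · ext e
      change (Algebra.TensorProduct.lift y₁ y₂ fun _ _ => Commute.all _ _) (e ⊗ₜ 1) = x₁ e
      rw [Algebra.TensorProduct.lift_tmul, map_one, mul_one]; rfl
    · ext e
      change (Algebra.TensorProduct.lift y₁ y₂ fun _ _ => Commute.all _ _) (1 ⊗ₜ e) = x₂ e
      rw [Algebra.TensorProduct.lift_tmul, map_one, one_mul]; rfl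
  · intro T _ _ x y h₁ h₂
    ext u
    induction u with
    | zero => simp
    | add u v hu hv => simp [hu, hv]
    | tmul a b =>
      have : a ⊗ₜ[E₀] b = i₁ a * i₂ b := by
        change a ⊗ₜ[E₀] b = (a ⊗ₜ 1) * (1 ⊗ₜ b)
        rw [Algebra.TensorProduct.tmul_mul_tmul, one_mul, mul_one]
      rw [this, map_mul, map_mul]
      exact congrArg₂ _ (DFunLike.congr_fun h₁ a) (DFunLike.congr_fun h₂ b)

end Pushout

section Category

variable {A : Type u} [CommRing A]

/-- The morphism of covers given by a homomorphism of algebras. -/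
def homMk {X Y : (CommAlgCat.FiniteEtale.{u} A)ᵒᵖ} (φ : Y.unop →ₐ[A] X.unop) : X ⟶ Y :=
  Quiver.Hom.op ⟨CommAlgCat.ofHom φ⟩

/-- The homomorphism of algebras underlying a morphism of covers. -/
def algHom {X Y : (CommAlgCat.FiniteEtale.{u} A)ᵒᵖ} (f : X ⟶ Y) : Y.unop →ₐ[A] X.unop :=
  f.unop.hom.hom

theorem hom_ext {X Y : (CommAlgCat.FiniteEtale.{u} A)ᵒᵖ} {f g : X ⟶ Y}
    (h : algHom f = algHom g) : f = g :=
  Quiver.Hom.unop_inj (ObjectProperty.hom_ext _ (CommAlgCat.hom_ext h))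

/-- The cover defined by an algebra. -/
abbrev mk (E : Type u) [CommRing E] [Algebra A E] [Module.Finite A E] [Algebra.Etale A E] :
    (CommAlgCat.FiniteEtale.{u} A)ᵒᵖ :=
  op (CommAlgCat.FiniteEtale.of A E)

variable (A) in
/-- The trivial cover is terminal. -/
def isTerminal : IsTerminal (mk A : (CommAlgCat.FiniteEtale.{u} A)ᵒᵖ) :=
  IsTerminal.ofUniqueHom (fun X => homMk (Algebra.ofId A X.unop))
    fun X _ => hom_ext (Subsingleton.elim (α := A →ₐ[A] X.unop) _ _)

instance : HasTerminal (CommAlgCat.FiniteEtale.{u} A)ᵒᵖ := (isTerminal A).hasTerminal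

theorem exists_pullbackCone {X Y Z : (CommAlgCat.FiniteEtale.{u} A)ᵒᵖ} (f : X ⟶ Z) (g : Y ⟶ Z) :
    ∃ c : PullbackCone f g, Nonempty (IsLimit c) ∧ ∀ (Ω : Type u) [Field Ω] [Algebra A Ω],
      Nonempty (IsLimit ((etaleFibre A Ω).mapCone c)) := by
  obtain ⟨P, _, _, _, _, i₁, i₂, hi, hl, hu⟩ := exists_pushout (algHom f) (algHom g)
  refine ⟨PullbackCone.mk (W := mk P) (homMk i₁) (homMk i₂) (hom_ext hi), ⟨?_⟩, fun Ω _ _ => ⟨?_⟩⟩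
  · refine PullbackCone.IsLimit.mk _
      (fun s => homMk (hl _ _ _ (congrArg algHom s.condition)).choose) ?_ ?_ ?_
    · exact fun s => hom_ext (hl _ _ _ (congrArg algHom s.condition)).choose_spec.1
    · exact fun s => hom_ext (hl _ _ _ (congrArg algHom s.condition)).choose_spec.2
    · intro s m h1 h2
      refine hom_ext (hu _ _ _ ?_ ?_)
      · exact (congrArg algHom h1).trans (hl _ _ _ (congrArg algHom s.condition)).choose_spec.1.symm
      · exact (congrArg algHom h2).trans (hl _ _ _ (congrArg algHom s.condition)).choose_spec.2.symm
  · refine (isLimitMapConePullbackConeEquiv (etaleFibre A Ω) _).symm ?_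
    have hs : ∀ (s : PullbackCone ((etaleFibre A Ω).map f) ((etaleFibre A Ω).map g)) (t : s.pt),
        (s.fst t : X.unop →ₐ[A] Ω).comp (algHom f) = (s.snd t : Y.unop →ₐ[A] Ω).comp (algHom g) :=
      fun s t => ConcreteCategory.congr_hom s.condition t
    refine PullbackCone.IsLimit.mk _
      (fun s => FintypeCat.homMk fun t => (hl Ω _ _ (hs s t)).choose) ?_ ?_ ?_
    · exact fun s => FintypeCat.hom_ext _ _ fun t => (hl Ω _ _ (hs s t)).choose_spec.1
    · exact fun s => FintypeCat.hom_ext _ _ fun t => (hl Ω _ _ (hs s t)).choose_spec.2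
    · intro s m h1 h2
      refine FintypeCat.hom_ext _ _ fun t => hu Ω _ _ ?_ ?_
      · exact (ConcreteCategory.congr_hom h1 t).trans (hl Ω _ _ (hs s t)).choose_spec.1.symm
      · exact (ConcreteCategory.congr_hom h2 t).trans (hl Ω _ _ (hs s t)).choose_spec.2.symm

instance : HasPullbacks (CommAlgCat.FiniteEtale.{u} A)ᵒᵖ :=
  @hasPullbacks_of_hasLimit_cospan _ _ fun {_ _ _ f g} =>
    let ⟨c, ⟨hc⟩, _⟩ := exists_pullbackCone f g
    ⟨⟨⟨c, hc⟩⟩⟩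

theorem preservesPullbacks_etaleFibre (Ω : Type u) [Field Ω] [Algebra A Ω] :
    PreservesLimitsOfShape WalkingCospan (etaleFibre A Ω) where
  preservesLimit {K} := by
    obtain ⟨c, ⟨hc⟩, h⟩ := exists_pullbackCone (K.map WalkingCospan.Hom.inl)
      (K.map WalkingCospan.Hom.inr)
    have := preservesLimit_of_preserves_limit_cone hc (h Ω).some
    exact preservesLimit_of_iso_diagram _ (diagramIsoCospan K).symm

theorem preservesTerminal_etaleFibre (Ω : Type u) [Field Ω] [Algebra A Ω] :
    PreservesLimitsOfShape (Discrete PEmpty.{1}) (etaleFibre A Ω) := by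
  have : PreservesLimit (Functor.empty.{0} _) (etaleFibre A Ω) :=
    preservesLimit_of_preserves_limit_cone (isTerminal A)
      ((isLimitMapConeEmptyConeEquiv (etaleFibre A Ω) (mk A)).symm
        (IsTerminal.ofUniqueHom (fun _ => FintypeCat.homMk fun _ => Algebra.ofId A Ω)
          fun _ _ => FintypeCat.hom_ext _ _ fun _ => Subsingleton.elim (α := A →ₐ[A] Ω) _ _))
  exact preservesLimitsOfShape_pempty_of_preservesTerminal _

section Coproducts

variable {ι : Type}

/-- A point of a finite disjoint union lies on one of the components. -/
theorem exists_comp_eval [Finite ι] {E : ι → Type u} {T : Type*} [∀ i, CommRing (E i)] [CommRing T]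
    [∀ i, Algebra A (E i)] [Algebra A T] [ConnectedSpace (PrimeSpectrum T)]
    (x : (∀ i, E i) →ₐ[A] T) : ∃ i, ∃ y : E i →ₐ[A] T, y.comp (Pi.evalAlgHom A E i) = x := by
  classical
  have := Fintype.ofFinite ι
  have := nontrivial_of_connectedSpace_primeSpectrum T
  have hid : ∀ i, x (Pi.single i 1) = 0 ∨ x (Pi.single i 1) = 1 := fun i =>
    eq_zero_or_one_of_isIdempotentElem (by
      rw [IsIdempotentElem, ← map_mul, ← Pi.single_mul, one_mul])
  have h1 : ∑ i, x (Pi.single i 1) = 1 := by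
    rw [← map_sum, ← map_one x]
    congr 1
    exact Finset.univ_sum_single (1 : ∀ i, E i)
  obtain ⟨i, hi⟩ : ∃ i, x (Pi.single i 1) = 1 := by
    by_contra! h
    rw [Finset.sum_eq_zero fun i _ => (hid i).resolve_right (h i)] at h1
    exact zero_ne_one h1
  have key : ∀ f, x (Pi.single i (f i)) = x f := fun f => by
    have : Pi.single i (f i) = f * Pi.single i 1 := by
      ext j
      by_cases h : j = i
      · subst h; simp
      · simp [h]
    rw [this, map_mul, hi, mul_one]
  refine ⟨i, { toFun := fun b => x (Pi.single i b)
               map_one' := hi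
               map_mul' := fun a b => by rw [Pi.single_mul, map_mul]
               map_zero' := by rw [Pi.single_zero, map_zero]
               map_add' := fun a b => by rw [Pi.single_add, map_add]
               commutes' := fun a => ?_ }, AlgHom.ext fun f => key f⟩
  exact (key (algebraMap A (∀ i, E i) a)).trans (x.commutes a)

theorem eq_of_comp_eval_eq {E : ι → Type u} {T : Type*} [∀ i, CommRing (E i)] [CommRing T]
    [∀ i, Algebra A (E i)] [Algebra A T] [Nontrivial T] {i j : ι} (y : E i →ₐ[A] T)
    (z : E j →ₐ[A] T) (h : y.comp (Pi.evalAlgHom A E i) = z.comp (Pi.evalAlgHom A E j)) :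
    i = j := by
  classical
  by_contra hij
  simpa [Pi.single_eq_of_ne (Ne.symm hij)] using DFunLike.congr_fun h (Pi.single i 1)

theorem comp_eval_injective {E : ι → Type u} {T : Type*} [∀ i, CommRing (E i)] [CommRing T]
    [∀ i, Algebra A (E i)] [Algebra A T] {i : ι} {y z : E i →ₐ[A] T}
    (h : y.comp (Pi.evalAlgHom A E i) = z.comp (Pi.evalAlgHom A E i)) : y = z := by
  classical
  ext e
  simpa using DFunLike.congr_fun h (Pi.single i e)

theorem exists_cofan [Finite ι] (X : ι → (CommAlgCat.FiniteEtale.{u} A)ᵒᵖ) :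
    ∃ c : Cofan X, Nonempty (IsColimit c) ∧ ∀ (Ω : Type u) [Field Ω] [Algebra A Ω],
      Nonempty (IsColimit ((etaleFibre A Ω).mapCocone c)) := by
  refine ⟨Cofan.mk (mk (∀ i, (X i).unop)) fun i => homMk (Pi.evalAlgHom A (fun i => (X i).unop) i),
    ⟨?_⟩, fun Ω _ _ => ⟨?_⟩⟩
  · refine Cofan.IsColimit.mk _ (fun s => homMk (AlgHom.pi fun i => algHom (s.inj i)))
      (fun s i => hom_ext rfl) fun s m hm => hom_ext (AlgHom.ext fun e => funext fun i => ?_)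
    exact DFunLike.congr_fun (congrArg algHom (hm i)) e
  · refine (isColimitMapCoconeCofanMkEquiv (etaleFibre A Ω) _ _).symm ?_
    choose i y hy using fun x : (∀ i, (X i).unop) →ₐ[A] Ω => exists_comp_eval x
    refine Cofan.IsColimit.mk _ (fun s => FintypeCat.homMk fun x => s.inj (i x) (y x)) ?_ ?_
    · intro s j
      refine FintypeCat.hom_ext _ _ fun z => ?_
      have h1 := hy (z.comp (Pi.evalAlgHom A (fun i => (X i).unop) j))
      have h2 := eq_of_comp_eval_eq _ _ h1
      change s.inj (i (z.comp (Pi.evalAlgHom A (fun i => (X i).unop) j)))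
        (y (z.comp (Pi.evalAlgHom A (fun i => (X i).unop) j))) = s.inj j z
      revert h1
      generalize y (z.comp (Pi.evalAlgHom A (fun i => (X i).unop) j)) = w
      revert w
      rw [h2]
      exact fun w hw => congrArg _ (comp_eval_injective hw)
    · intro s m hm
      refine FintypeCat.hom_ext _ _ fun x => ?_
      have h := ConcreteCategory.congr_hom (hm (i x)) (y x)
      refine Eq.trans ?_ h
      exact congrArg m (hy x).symm

instance : HasFiniteCoproducts (CommAlgCat.FiniteEtale.{u} A)ᵒᵖ where
  out n :=
    have : ∀ X : Fin n → (CommAlgCat.FiniteEtale.{u} A)ᵒᵖ, HasColimit (Discrete.functor X) := fun X =>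
      let ⟨c, ⟨hc⟩, _⟩ := exists_cofan X
      ⟨⟨⟨c, hc⟩⟩⟩
    { has_colimit := fun _ => hasColimit_of_iso Discrete.natIsoFunctor }

theorem preservesFiniteCoproducts_etaleFibre (Ω : Type u) [Field Ω] [Algebra A Ω] :
    PreservesFiniteCoproducts (etaleFibre A Ω) where
  preserves n :=
    { preservesColimit := fun {K} => by
        obtain ⟨c, ⟨hc⟩, h⟩ := exists_cofan (K.obj ∘ Discrete.mk)
        have := preservesColimit_of_preserves_colimit_cocone hc (h Ω).some
        exact preservesColimit_of_iso_diagram _ Discrete.natIsoFunctor.symm }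

end Coproducts

section Coequalizers

/-- A map between étale A-algebras is étale. For a surjection, formal étaleness makes the kernel an
idempotent ideal and finite presentation makes it finitely generated, so an idempotent generates it.
-/
theorem exists_span_eq_ker_of_surjective {E E' : Type u} [CommRing E] [CommRing E'] [Algebra A E]
    [Algebra A E'] [Algebra.Etale A E] [Algebra.Etale A E'] (f : E →ₐ[A] E')
    (hf : Function.Surjective f) :
    ∃ e : E, IsIdempotentElem e ∧ RingHom.ker f = Ideal.span {e} := by
  algebraize [f.toRingHom]
  have : IsScalarTower A E E' := .of_algebraMap_eq' f.comp_algebraMap.symm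
  have : Algebra.Etale E E' := Algebra.Etale.of_restrictScalars A _ _
  have h1 : IsIdempotentElem (RingHom.ker (algebraMap E E')) :=
    (Algebra.FormallyEtale.iff_of_surjective hf).1 inferInstance
  have h2 : (RingHom.ker (algebraMap E E')).FG :=
    Algebra.FinitePresentation.ker_fG_of_surjective (Algebra.ofId E E') hf
  exact (Ideal.isIdempotentElem_iff_of_fg _ h2).1 h1

/-- The kernel is generated by an idempotent e, so Y is the product of E/(e) = X and the
complementary factor E/(1 - e), where E is the algebra of Y. -/
theorem exists_summand_of_surjective {X Y : (CommAlgCat.FiniteEtale.{u} A)ᵒᵖ} (i : X ⟶ Y)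
    (hi : Function.Surjective (algHom i)) :
    ∃ (Z : (CommAlgCat.FiniteEtale.{u} A)ᵒᵖ) (u : Z ⟶ Y),
      Nonempty (IsColimit (BinaryCofan.mk i u)) := by
  obtain ⟨e, he, hker⟩ := exists_span_eq_ker_of_surjective (algHom i) hi
  have := etale_quotient_span_isIdempotentElem A he.one_sub
  have hf : IsIdempotentElem (1 - e) := he.one_sub
  have hie : ∀ y, algHom i y = 0 ↔ ∃ c, y = e * c := fun y => by
    rw [← RingHom.mem_ker, hker, Ideal.mem_span_singleton']
    simp only [mul_comm e, eq_comm]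
  have hie0 : algHom i e = 0 := (hie e).2 ⟨1, (mul_one e).symm⟩
  refine ⟨mk (Y.unop ⧸ Ideal.span {1 - e}), homMk (Ideal.Quotient.mkₐ A _), ⟨?_⟩⟩
  let φ : Y.unop →ₐ[A] X.unop × (Y.unop ⧸ Ideal.span {1 - e}) :=
    (algHom i).prod (Ideal.Quotient.mkₐ A _)
  have hφ : Function.Bijective φ := by
    constructor
    · rw [injective_iff_map_eq_zero]
      intro y hy
      obtain ⟨c, rfl⟩ := (hie y).1 (congrArg Prod.fst hy)
      have h2 : Ideal.Quotient.mk (Ideal.span {1 - e}) (e * c) = 0 := congrArg Prod.snd hy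
      rw [Ideal.Quotient.eq_zero_iff_mem, Ideal.mem_span_singleton'] at h2
      obtain ⟨d, hd⟩ := h2
      calc e * c = e * (e * c) := by rw [← mul_assoc, he.eq]
        _ = d * (e - e * e) := by rw [← hd]; ring
        _ = 0 := by rw [he.eq, sub_self, mul_zero]
    · rintro ⟨a, b⟩
      obtain ⟨y, rfl⟩ := hi a
      obtain ⟨z, rfl⟩ := Ideal.Quotient.mk_surjective b
      refine ⟨(1 - e) * y + e * z, Prod.ext ?_ ?_⟩
      · change algHom i ((1 - e) * y + e * z) = algHom i y
        simp [hie0]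
      · change Ideal.Quotient.mk _ ((1 - e) * y + e * z) = Ideal.Quotient.mk _ z
        rw [Ideal.Quotient.eq, Ideal.mem_span_singleton']
        exact ⟨y - z, by ring⟩
  let θ := AlgEquiv.ofBijective φ hφ
  refine BinaryCofan.IsColimit.mk _
    (fun s t => homMk (θ.symm.toAlgHom.comp ((algHom s).prod (algHom t)))) ?_ ?_ ?_
  · intro T s t
    refine hom_ext (AlgHom.ext fun x => ?_)
    exact congrArg Prod.fst (θ.apply_symm_apply (algHom s x, algHom t x))
  · intro T s t
    refine hom_ext (AlgHom.ext fun x => ?_)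
    exact congrArg Prod.snd (θ.apply_symm_apply (algHom s x, algHom t x))
  · intro T s t m h1 h2
    refine hom_ext (AlgHom.ext fun x => θ.injective ?_)
    refine (Prod.ext ?_ ?_ : θ (algHom m x) = (algHom s x, algHom t x)).trans
      (θ.apply_symm_apply _).symm
    · exact DFunLike.congr_fun (congrArg algHom h1) x
    · exact DFunLike.congr_fun (congrArg algHom h2) x

variable [ConnectedSpace (PrimeSpectrum A)]

theorem exists_cofork {X Y : (CommAlgCat.FiniteEtale.{u} A)ᵒᵖ} (f g : X ⟶ Y) :
    ∃ c : Cofork f g, Nonempty (IsColimit c) ∧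
      ∀ (Ω : Type u) [Field Ω] [IsAlgClosed Ω] [Algebra A Ω],
        Nonempty (IsColimit ((etaleFibre A Ω).mapCocone c)) := by
  obtain ⟨_, _⟩ := etale_equalizer (algHom f) (algHom g)
  let S := AlgHom.equalizer (algHom f) (algHom g)
  have hw : f ≫ homMk (Y := mk S) S.val = g ≫ homMk S.val :=
    hom_ext (AlgHom.ext fun s => s.2)
  refine ⟨Cofork.ofπ (homMk (Y := mk S) S.val) hw, ⟨?_⟩, fun Ω _ _ _ => ⟨?_⟩⟩
  · refine Cofork.IsColimit.mk _
      (fun s => homMk ((algHom s.π).codRestrict S fun e =>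
        DFunLike.congr_fun (congrArg algHom s.condition) e))
      (fun s => hom_ext rfl) fun s m hm => hom_ext (AlgHom.ext fun e => Subtype.ext ?_)
    exact DFunLike.congr_fun (congrArg algHom hm) e
  · refine (isColimitMapCoconeCoforkEquiv (etaleFibre A Ω) hw).symm ?_
    choose ext hext using fun y : S →ₐ[A] Ω => exists_extension_of_equalizer (algHom f) (algHom g) y
    -- Points of the equalizer extend to points of the ambient algebra, and any map coequalizing the
    -- two fibre maps does not depend on the chosen extension.
    refine Cofork.IsColimit.mk _ (fun s => FintypeCat.homMk fun y => s.π (ext y)) ?_ ?_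
    · intro s
      refine FintypeCat.hom_ext _ _ fun x => ?_
      exact eq_of_eq_on_equalizer (algHom f) (algHom g) (hext (x.comp S.val)) (fun x => s.π x)
        fun z => ConcreteCategory.congr_hom s.condition z
    · intro s m hm
      refine FintypeCat.hom_ext _ _ fun y => ?_
      refine Eq.trans ?_ (ConcreteCategory.congr_hom hm (ext y))
      exact congrArg m (hext y).symm

instance : HasCoequalizers (CommAlgCat.FiniteEtale.{u} A)ᵒᵖ :=
  @hasCoequalizers_of_hasColimit_parallelPair _ _ fun {_ _ f g} =>
    let ⟨c, ⟨hc⟩, _⟩ := exists_cofork f g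
    ⟨⟨⟨c, hc⟩⟩⟩

theorem preservesCoequalizers_etaleFibre (Ω : Type u) [Field Ω] [IsAlgClosed Ω] [Algebra A Ω] :
    PreservesColimitsOfShape WalkingParallelPair (etaleFibre A Ω) where
  preservesColimit {K} := by
    obtain ⟨c, ⟨hc⟩, h⟩ := exists_cofork (K.map WalkingParallelPairHom.left)
      (K.map WalkingParallelPairHom.right)
    have := preservesColimit_of_preserves_colimit_cocone hc (h Ω).some
    exact preservesColimit_of_iso_diagram _ (diagramIsoParallelPair K).symm

instance : HasFiniteColimits (CommAlgCat.FiniteEtale.{u} A)ᵒᵖ :=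
  hasFiniteColimits_of_hasCoequalizers_and_finite_coproducts

theorem preservesFiniteColimits_etaleFibre (Ω : Type u) [Field Ω] [IsAlgClosed Ω] [Algebra A Ω] :
    PreservesFiniteColimits (etaleFibre A Ω) :=
  have := preservesCoequalizers_etaleFibre (A := A) Ω
  have := preservesFiniteCoproducts_etaleFibre (A := A) Ω
  preservesFiniteColimits_of_preservesCoequalizers_and_finiteCoproducts _

theorem reflectsIsomorphisms_etaleFibre (Ω : Type u) [Field Ω] [IsAlgClosed Ω] [Algebra A Ω] :
    (etaleFibre A Ω).ReflectsIsomorphisms where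
  reflects {X Y} f hf := by
    have hb : Function.Bijective fun x : X.unop →ₐ[A] Ω => x.comp (algHom f) :=
      (ConcreteCategory.isIso_iff_bijective ((etaleFibre A Ω).map f)).1 hf
    let e := AlgEquiv.ofBijective (algHom f) (bijective_of_points_bijective Ω _ hb)
    refine ⟨homMk e.symm.toAlgHom, hom_ext (AlgHom.ext fun x => ?_), hom_ext (AlgHom.ext fun x => ?_)⟩
    · exact e.apply_symm_apply x
    · exact e.symm_apply_apply x

end Coequalizers

section Galois

variable [ConnectedSpace (PrimeSpectrum A)]

theorem algHom_surjective_of_mono {X Y : (CommAlgCat.FiniteEtale.{u} A)ᵒᵖ} (i : X ⟶ Y) [Mono i] :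
    Function.Surjective (algHom i) := by
  obtain ⟨p⟩ := (inferInstance : Nonempty (PrimeSpectrum A))
  -- Any geometric point will do; the fibre functor preserves pullbacks and so sends monomorphisms
  -- to injections.
  let Ω := AlgebraicClosure (FractionRing (A ⧸ p.asIdeal))
  have := preservesPullbacks_etaleFibre (A := A) Ω
  refine surjective_of_points_injective Ω (algHom i) ?_
  exact (ConcreteCategory.mono_iff_injective_of_preservesPullback ((etaleFibre A Ω).map i)).1
    inferInstance

instance : PreGaloisCategory (CommAlgCat.FiniteEtale.{u} A)ᵒᵖ where
  hasQuotientsByFiniteGroups G _ _ := by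
    obtain ⟨G', _, _, ⟨e⟩⟩ := Finite.exists_type_univ_nonempty_mulEquiv.{u, 0} G
    have := Fintype.ofFinite G'
    exact Limits.hasColimitsOfShape_of_equivalence e.toSingleObjEquiv.symm
  monoInducesIsoOnDirectSummand i _ := exists_summand_of_surjective i (algHom_surjective_of_mono i)

instance (Ω : Type u) [Field Ω] [IsAlgClosed Ω] [Algebra A Ω] :
    PreGaloisCategory.FiberFunctor (etaleFibre A Ω) :=
  have := preservesFiniteColimits_etaleFibre (A := A) Ω
  { preservesTerminalObjects := preservesTerminal_etaleFibre Ω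
    preservesPullbacks := preservesPullbacks_etaleFibre Ω
    preservesFiniteCoproducts := preservesFiniteCoproducts_etaleFibre Ω
    preservesQuotientsByFiniteGroups := fun G _ _ => by
      obtain ⟨G', _, _, ⟨e⟩⟩ := Finite.exists_type_univ_nonempty_mulEquiv.{u, 0} G
      have := Fintype.ofFinite G'
      exact Limits.preservesColimitsOfShape_of_equiv e.toSingleObjEquiv.symm _
    reflectsIsos := reflectsIsomorphisms_etaleFibre Ω }

end Galois

end Category

end EtaleCover

end

/-! ### Actions of the fundamental group and additive Hilbert 90 -/

section

open TensorProduct Limits Opposite PreGaloisCategory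

namespace EtaleCover

instance {A : Type u} [CommRing A] {Ω : Type u} [Field Ω] [Algebra A Ω] {E : Type u} [CommRing E]
    [Algebra A E] [Module.Finite A E] [Algebra.Etale A E] :
    MulAction (etalePi1 A Ω) (E →ₐ[A] Ω) :=
  inferInstanceAs (MulAction (Aut (etaleFibre A Ω)) ((etaleFibre A Ω).obj (mk E)))

theorem smul_comp {A : Type u} [CommRing A] {Ω : Type u} [Field Ω] [Algebra A Ω] {E E' : Type u}
    [CommRing E] [Algebra A E] [Module.Finite A E] [Algebra.Etale A E] [CommRing E'] [Algebra A E']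
    [Module.Finite A E'] [Algebra.Etale A E'] (γ : etalePi1 A Ω) (x : E' →ₐ[A] Ω)
    (f : E →ₐ[A] E') : γ • x.comp f = (γ • x).comp f :=
  mulAction_naturality (etaleFibre A Ω) γ (homMk (X := mk E') (Y := mk E) f) x

/-- Faithfully flat descent for solving a linear equation: the class of n in the cokernel vanishes
after base change, hence before. -/
theorem mem_range_of_lTensor {A B M N : Type*} [CommRing A] [CommRing B] [Algebra A B]
    [Module.FaithfullyFlat A B]
    [AddCommGroup M] [Module A M] [AddCommGroup N] [Module A N] (f : M →ₗ[A] N) (n : N)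
    (u : B ⊗[A] M) (hu : f.lTensor B u = 1 ⊗ₜ n) : ∃ m, f m = n := by
  have h : (LinearMap.range f).mkQ n = 0 := by
    refine (Module.FaithfullyFlat.one_tmul_eq_zero_iff A _ (A := B) _).1 ?_
    have h1 : (LinearMap.range f).mkQ ∘ₗ f = 0 := by
      ext m; simp
    have h2 : ((LinearMap.range f).mkQ.lTensor B) (f.lTensor B u) = 0 := by
      rw [← LinearMap.comp_apply, ← LinearMap.lTensor_comp, h1, LinearMap.lTensor_zero,
        LinearMap.zero_apply]
    rw [hu, LinearMap.lTensor_tmul] at h2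
    exact h2
  exact (Submodule.Quotient.mk_eq_zero _).1 h

section

variable {A : Type u} [CommRing A] [ConnectedSpace (PrimeSpectrum A)]

instance : GaloisCategory (CommAlgCat.FiniteEtale.{u} A)ᵒᵖ where
  hasFiberFunctor := by
    obtain ⟨p⟩ := (inferInstance : Nonempty (PrimeSpectrum A))
    exact ⟨etaleFibre A (AlgebraicClosure (FractionRing (A ⧸ p.asIdeal))), ⟨inferInstance⟩⟩

variable {Ω : Type u} [Field Ω] [IsAlgClosed Ω] [Algebra A Ω]

/-- Fullness of the functor from covers to finite sets with an action of the fundamental group. -/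
theorem exists_hom_of_equivariant {X Y : (CommAlgCat.FiniteEtale.{u} A)ᵒᵖ}
    (t : (etaleFibre A Ω).obj X → (etaleFibre A Ω).obj Y)
    (ht : ∀ (γ : etalePi1 A Ω) x, t (γ • x) = γ • t x) :
    ∃ f : X ⟶ Y, ∀ x, (etaleFibre A Ω).map f x = t x := by
  let φ : (functorToAction (etaleFibre A Ω)).obj X ⟶ (functorToAction (etaleFibre A Ω)).obj Y :=
    { hom := FintypeCat.homMk t
      comm := fun γ => FintypeCat.hom_ext _ _ fun x => ht γ x }
  obtain ⟨f, hf⟩ := (functorToAction (etaleFibre A Ω)).map_surjective φ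
  refine ⟨f, fun x => ?_⟩
  have := congrArg Action.Hom.hom hf
  exact ConcreteCategory.congr_hom this x

/-- A point of a cover fixed by the fundamental group comes from a section. -/
theorem exists_section_of_fixed {E : Type u} [CommRing E] [Algebra A E] [Module.Finite A E]
    [Algebra.Etale A E] (y : E →ₐ[A] Ω)
    (hy : ∀ γ : etalePi1 A Ω, γ • y = y) :
    ∃ s : E →ₐ[A] A, (Algebra.ofId A Ω).comp s = y := by
  obtain ⟨f, hf⟩ := exists_hom_of_equivariant (X := mk A) (Y := mk E) (Ω := Ω) (fun _ => y)
    fun γ _ => (hy γ).symm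
  exact ⟨algHom f, hf (Algebra.ofId A Ω)⟩

open scoped FintypeCatDiscrete in
-- Essential surjectivity in Galois theory; open point stabilizers are exactly continuity of the
-- action on a finite discrete set.
theorem exists_cover_of_action {S : Type u} [Finite S] [MulAction (etalePi1 A Ω) S]
    (hS : ∀ s : S, IsOpen {γ : etalePi1 A Ω | γ • s = s}) :
    ∃ (X : (CommAlgCat.FiniteEtale.{u} A)ᵒᵖ) (θ : (etaleFibre A Ω).obj X ≃ S),
      ∀ (γ : etalePi1 A Ω) x, θ (γ • x) = γ • θ x := by
  let Z : Action FintypeCat.{u} (etalePi1 A Ω) :=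
    Action.FintypeCat.ofMulAction (etalePi1 A Ω) (FintypeCat.of S)
  have hZ : Z.IsContinuous := by
    have hd : DiscreteTopology ((forget₂ (Action FintypeCat.{u} (etalePi1 A Ω)) TopCat).obj Z) :=
      ⟨rfl⟩
    have hd' : DiscreteTopology ((forget₂ FintypeCat.{u} TopCat).obj Z.V) := ⟨rfl⟩
    rw [Action.isContinuous_def]
    refine continuous_prod_of_discrete_right.2 fun s => continuous_discrete_rng.2 fun s' => ?_
    by_cases h : ∃ γ₀ : etalePi1 A Ω, γ₀ • (s : S) = s'
    · obtain ⟨γ₀, rfl⟩ := h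
      -- The elements carrying s to γ₀ • s form a translate of the stabilizer of s.
      have : IsOpen ((fun γ => γ₀⁻¹ * γ) ⁻¹' {γ : etalePi1 A Ω | γ • (s : S) = s}) :=
        (hS s).preimage (continuous_const_mul _)
      convert this using 1
      ext γ
      change γ • (s : S) = γ₀ • (s : S) ↔ (γ₀⁻¹ * γ) • (s : S) = s
      rw [mul_smul, inv_smul_eq_iff]
    · convert isOpen_empty
      ext γ
      exact ⟨fun hγ => h ⟨γ, hγ⟩, False.elim⟩
  let X := (functorToContAction (etaleFibre A Ω)).objPreimage ⟨Z, hZ⟩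
  let j : (functorToAction (etaleFibre A Ω)).obj X ≅ Z :=
    (ObjectProperty.ι _).mapIso ((functorToContAction (etaleFibre A Ω)).objObjPreimageIso ⟨Z, hZ⟩)
  refine ⟨X, FintypeCat.equivEquivIso.symm ((Action.forget _ _).mapIso j), fun γ x => ?_⟩
  exact ConcreteCategory.congr_hom (j.hom.comm γ) x

theorem algHom_ext_of_points {E E' : Type u} [CommRing E] [Algebra A E] [Module.Finite A E]
    [Algebra.Etale A E] [CommRing E'] [Algebra A E'] [Module.Finite A E'] [Algebra.Etale A E']
    (Ω : Type u) [Field Ω] [IsAlgClosed Ω] [Algebra A Ω]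
    {f g : E →ₐ[A] E'} (h : ∀ x : E' →ₐ[A] Ω, x.comp f = x.comp g) : f = g := by
  have := (etaleFibre A Ω).map_injective (a₁ := homMk (X := mk E') (Y := mk E) f) (a₂ := homMk g)
    (FintypeCat.hom_ext _ _ h)
  exact congrArg algHom this

/-- If `G` acts on `E` so that the points of `E` form a torsor, then `E ⊗ E` is a product of copies
of `E`. -/
theorem torsorMap_bijective {G : Type} [Finite G] {E : Type u} [CommRing E] [Algebra A E]
    [Module.Finite A E] [Algebra.Etale A E] (Ω : Type u) [Field Ω] [IsAlgClosed Ω] [Algebra A Ω]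
    (σ : G → (E →ₐ[A] E)) (hσ : ∀ x y : E →ₐ[A] Ω, ∃! i, x.comp (σ i) = y) :
    Function.Bijective (AlgHom.pi fun i : G =>
      Algebra.TensorProduct.lift (AlgHom.id A E) (σ i) fun _ _ => Commute.all _ _) := by
  have : Module.Finite A (E ⊗[A] E) := Module.Finite.trans E _
  have : Algebra.Etale A (E ⊗[A] E) := Algebra.Etale.comp A E _
  -- A point of the product is a pair (i, x) and goes to the pair (x, x ∘ σ i). The torsor condition
  -- says that every pair of points arises exactly once.
  refine bijective_of_points_bijective Ω _ ⟨fun v w hvw => ?_, fun y => ?_⟩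
  · obtain ⟨i, x, rfl⟩ := exists_comp_eval v
    obtain ⟨j, y, rfl⟩ := exists_comp_eval w
    have h1 : x = y := by
      ext e
      simpa using DFunLike.congr_fun hvw (e ⊗ₜ 1)
    subst h1
    have h2 : i = j := by
      refine (hσ x (x.comp (σ j))).unique ?_ rfl
      ext e
      simpa using DFunLike.congr_fun hvw (1 ⊗ₜ e)
    subst h2
    rfl
  · let y₁ : E →ₐ[A] Ω := y.comp Algebra.TensorProduct.includeLeft
    let y₂ : E →ₐ[A] Ω := y.comp Algebra.TensorProduct.includeRight
    obtain ⟨i, hi, -⟩ := hσ y₁ y₂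
    refine ⟨y₁.comp (Pi.evalAlgHom A (fun _ => E) i), ?_⟩
    refine Algebra.TensorProduct.ext' fun a b => ?_
    have hb : y₁ (σ i b) = y₂ b := DFunLike.congr_fun hi b
    calc y₁ (a * σ i b) = y₁ a * y₂ b := by rw [map_mul, hb]
      _ = y (a ⊗ₜ b) := by
        change y (a ⊗ₜ 1) * y (1 ⊗ₜ b) = _
        rw [← map_mul, Algebra.TensorProduct.tmul_mul_tmul, one_mul, mul_one]

/-- Additive Hilbert 90: every character of the fundamental group with values in `ℤ/p` is given by
an Artin–Schreier equation. -/
theorem exists_artinSchreier_of_character {p : ℕ} [Fact p.Prime] [CharP A p]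
    (χ : etalePi1 A Ω →* Multiplicative (ZMod p)) (hχ : IsOpen {γ | χ γ = 1}) :
    ∃ (E : Type u) (_ : CommRing E) (_ : Algebra A E) (_ : Module.Finite A E)
      (_ : Algebra.Etale A E) (_ : E →ₐ[A] Ω) (z : E) (a : A), z ^ p - z = algebraMap A E a ∧
        ∀ (γ : etalePi1 A Ω) (x : E →ₐ[A] Ω),
          (γ • x) z = x z + ((Multiplicative.toAdd (χ γ)).val : Ω) := by
  let _ : MulAction (etalePi1 A Ω) (ULift.{u} (ZMod p)) :=
    { smul := fun γ i => ⟨i.down + Multiplicative.toAdd (χ γ)⟩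
      one_smul := fun i => ULift.ext _ _ (by
        change i.down + Multiplicative.toAdd (χ 1) = i.down
        simp)
      mul_smul := fun γ δ i => ULift.ext _ _ (by
        change i.down + Multiplicative.toAdd (χ (γ * δ)) =
          i.down + Multiplicative.toAdd (χ δ) + Multiplicative.toAdd (χ γ)
        rw [map_mul, toAdd_mul]; ring) }
  -- The ℤ/p-torsor attached to χ: the fundamental group acts on ℤ/p by translation through χ. It is
  -- disconnected when χ is trivial, which does no harm.
  obtain ⟨X, θ, hθ⟩ := exists_cover_of_action (A := A) (Ω := Ω) (S := ULift.{u} (ZMod p)) fun s => by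
    convert hχ using 3 with γ
    rw [ULift.ext_iff]
    change s.down + Multiplicative.toAdd (χ γ) = s.down ↔ _
    rw [add_eq_left, toAdd_eq_zero]
  let E : Type u := X.unop
  let θ' : (E →ₐ[A] Ω) ≃ ZMod p := θ.trans Equiv.ulift
  have hθ' : ∀ (γ : etalePi1 A Ω) (x : E →ₐ[A] Ω),
      θ' (γ • x) = θ' x + Multiplicative.toAdd (χ γ) := fun γ x => congrArg ULift.down (hθ γ x)
  have hσ : ∀ i : ZMod p, ∃ σ : E →ₐ[A] E, ∀ x : E →ₐ[A] Ω, x.comp σ = θ'.symm (θ' x + i) := by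
    intro i
    obtain ⟨f, hf⟩ := exists_hom_of_equivariant (X := X) (Y := X) (Ω := Ω)
      (fun x => θ'.symm (θ' x + i)) fun γ x => by
        apply θ'.injective
        refine (θ'.apply_symm_apply _).trans ?_
        have h1 := hθ' γ x
        have h2 := hθ' γ (θ'.symm (θ' x + i))
        rw [θ'.apply_symm_apply] at h2
        refine Eq.trans ?_ h2.symm
        refine (congrArg (· + i) h1).trans ?_
        ring
    exact ⟨algHom f, hf⟩
  choose σ hσ using hσ
  have hσ0 : σ 0 = AlgHom.id A E := algHom_ext_of_points Ω fun x => by simp [hσ]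
  have hσadd : ∀ i j, (σ i).comp (σ j) = σ (i + j) := fun i j => algHom_ext_of_points Ω fun x => by
    rw [← AlgHom.comp_assoc, hσ, hσ, hσ, θ'.apply_symm_apply, add_assoc]
  let x₀ : E →ₐ[A] Ω := θ'.symm 0
  have : Nontrivial E := x₀.toRingHom.domain_nontrivial
  have := faithfullyFlat_of_connected A E
  have : CharP E p := charP_of_injective_algebraMap (FaithfulSMul.algebraMap_injective A E) p
  have hΦ := torsorMap_bijective Ω σ fun x y =>
    ⟨θ' y - θ' x, (hσ _ _).trans (by simp), fun i hi => by
      rw [← hi, hσ, θ'.apply_symm_apply, add_sub_cancel_left]⟩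
  -- Pulled back to itself the torsor is trivial, and there the function i ↦ i grows by 1 under
  -- translation by 1. Descent then solves σ 1 z = z + 1 in E.
  obtain ⟨u, hu⟩ := hΦ.2 fun i => (i.val : E)
  have hΦt : ∀ a b i, (AlgHom.pi fun i => Algebra.TensorProduct.lift (AlgHom.id A E) (σ i)
      fun _ _ => Commute.all _ _) (a ⊗ₜ b) i = a * σ i b := fun a b i => by simp
  have hz : ∃ z : E, σ 1 z = z + 1 := by
    obtain ⟨z, hz⟩ := mem_range_of_lTensor ((σ 1).toLinearMap - LinearMap.id) (1 : E) u <| by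
      rw [LinearMap.lTensor_sub, LinearMap.lTensor_id, LinearMap.sub_apply, LinearMap.id_apply,
        sub_eq_iff_eq_add]
      apply hΦ.1
      have h1 : ∀ (v : E ⊗[A] E) i, (AlgHom.pi fun i => Algebra.TensorProduct.lift (AlgHom.id A E)
          (σ i) fun _ _ => Commute.all _ _) ((σ 1).toLinearMap.lTensor E v) i =
          (AlgHom.pi fun i => Algebra.TensorProduct.lift (AlgHom.id A E) (σ i)
            fun _ _ => Commute.all _ _) v (i + 1) := by
        intro v i
        induction v with
        | zero => simp
        | tmul a b => rw [LinearMap.lTensor_tmul, hΦt, hΦt, ← hσadd]; rfl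
        | add v w hv hw => rw [map_add, map_add, map_add, Pi.add_apply, Pi.add_apply, hv, hw]
      ext i
      rw [h1, map_add, hu, Pi.add_apply, hΦt, map_one, mul_one]
      change ((i + 1).val : E) = 1 + (i.val : E)
      rw [ZMod.natCast_val, ZMod.natCast_val, ZMod.cast_add', ZMod.cast_one', add_comm]
    exact ⟨z, by rw [← hz]; simp⟩
  obtain ⟨z, hz⟩ := hz
  have hzn : ∀ n : ℕ, σ n z = z + n := by
    intro n
    induction n with
    | zero => simp [hσ0]
    | succ n ih =>
      rw [Nat.cast_succ, ← hσadd, AlgHom.comp_apply, hz, map_add, ih, map_one]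
      push_cast; ring
  have ha : ∃ a : A, z ^ p - z = algebraMap A E a := by
    -- σ i z = z + i, and i^p = i in the prime field.
    have hinv : ∀ i, σ i (z ^ p - z) = z ^ p - z := by
      intro i
      rw [← ZMod.natCast_zmod_val i, map_sub, map_pow, hzn, add_pow_char, ← Nat.cast_pow,
        ← map_natCast (ZMod.castHom dvd_rfl E) (i.val ^ p), Nat.cast_pow, ZMod.pow_card,
        map_natCast]
      ring
    -- Invariance says that the two images of z^p - z in E ⊗ E have the same coordinates, which is
    -- the descent condition for lying in A.
    obtain ⟨a, ha⟩ := mem_range_of_lTensor (Algebra.linearMap A E) (z ^ p - z)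
      ((z ^ p - z) ⊗ₜ[A] (1 : A)) <| by
        apply hΦ.1
        ext i
        rw [LinearMap.lTensor_tmul, hΦt, hΦt, Algebra.linearMap_apply, map_one, map_one, hinv,
          mul_one, one_mul]
    exact ⟨a, ha.symm⟩
  obtain ⟨a, ha⟩ := ha
  refine ⟨E, inferInstance, inferInstance, inferInstance, inferInstance, x₀, z, a, ha, fun γ x => ?_⟩
  have h1 : γ • x = x.comp (σ (Multiplicative.toAdd (χ γ))) := by
    rw [hσ, ← hθ', θ'.symm_apply_apply]
  rw [h1, AlgHom.comp_apply]
  conv_lhs => rw [← ZMod.natCast_zmod_val (Multiplicative.toAdd (χ γ))]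
  rw [hzn, map_add, map_natCast]

end

end EtaleCover

end

/-! ### Artin–Schreier algebras and the Frobenius condition -/

section

open TensorProduct Limits Opposite PreGaloisCategory Polynomial

/-- The Artin–Schreier polynomial. -/
noncomputable def asPoly {A : Type*} [CommRing A] (p : ℕ) (a : A) : A[X] := X ^ p - (X + C a)

/-- The Artin–Schreier algebra `A[x] / (x ^ p - x - a)`. -/
abbrev ArtinSchreier {A : Type*} [CommRing A] (p : ℕ) (a : A) : Type _ := AdjoinRoot (asPoly p a)

/-- A ring homomorphism `A → B` in characteristic `p` such that `x ↦ x ^ p - x` is bijective on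
`B / A`. -/
structure IsFrobeniusIso (p : ℕ) {A B : Type*} [CommRing A] [CommRing B] (f : A →+* B) : Prop where
  injective : Function.Injective f
  mem_range : ∀ b, b ^ p - b ∈ f.range → b ∈ f.range
  exists_sub_mem : ∀ b, ∃ c, b - (c ^ p - c) ∈ f.range

section ArtinSchreier

variable {A B : Type*} [CommRing A] [CommRing B] {p : ℕ} [hp : Fact p.Prime]

theorem degree_X_add_C_lt (a : A) : (X + C a : A[X]).degree < (p : ℕ) :=
  lt_of_le_of_lt (degree_add_le _ _) (max_lt (lt_of_le_of_lt degree_X_le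
    (by exact_mod_cast hp.out.one_lt)) (lt_of_le_of_lt degree_C_le
    (by exact_mod_cast hp.out.pos)))

theorem asPoly_monic (a : A) : (asPoly p a).Monic :=
  monic_X_pow_sub (degree_X_add_C_lt a)

theorem degree_asPoly [Nontrivial A] (a : A) : (asPoly p a).degree = (p : ℕ) := by
  rw [asPoly, degree_sub_eq_left_of_degree_lt] <;> rw [degree_X_pow]
  exact degree_X_add_C_lt a

instance (a : A) : Module.Finite A (ArtinSchreier p a) := (asPoly_monic a).finite_adjoinRoot

instance [CharP A p] (a : A) : Algebra.Etale A (ArtinSchreier p a) := by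
  let P : StandardEtalePair A :=
    { f := asPoly p a
      monic_f := asPoly_monic a
      g := 1
      -- In characteristic p the derivative of x^p - x - a is the unit -1, so nothing has to be
      -- inverted.
      cond := ⟨-1, 0, 0, by simp [asPoly, derivative_X_pow]⟩ }
  have h1 : IsUnit (AdjoinRoot.mk P.f P.g) := by simp [P]
  let e := IsLocalization.atUnit (ArtinSchreier p a) (Localization.Away (AdjoinRoot.mk P.f P.g)) _ h1
  exact Algebra.Etale.of_equiv (P.equivAwayAdjoinRoot.trans (e.restrictScalars A).symm)

theorem ArtinSchreier.root_pow (a : A) :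
    (AdjoinRoot.root (asPoly p a)) ^ p = AdjoinRoot.root (asPoly p a) + algebraMap A _ a := by
  have := AdjoinRoot.mk_self (f := asPoly p a)
  conv at this => lhs; arg 2; rw [asPoly]
  rwa [map_sub, map_add, map_pow, AdjoinRoot.mk_X, AdjoinRoot.mk_C, sub_eq_zero] at this

/-- Homomorphisms out of an Artin–Schreier algebra are given by roots. -/
noncomputable def ArtinSchreier.lift [Algebra A B] {a : A} (x : B)
    (hx : x ^ p = x + algebraMap A B a) :
    ArtinSchreier p a →ₐ[A] B :=
  AdjoinRoot.liftAlgHom _ (Algebra.ofId A B) x (by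
    simp [asPoly, hx])

@[simp]
theorem ArtinSchreier.lift_root [Algebra A B] {a : A} (x : B) (hx : x ^ p = x + algebraMap A B a) :
    ArtinSchreier.lift x hx (AdjoinRoot.root _) = x :=
  AdjoinRoot.liftAlgHom_root _ _ _ _

theorem asPoly_map (f : A →+* B) (a : A) : (asPoly p a).map f = asPoly p (f a) := by
  simp [asPoly]

/-- Functoriality of the Artin–Schreier algebra. -/
noncomputable def ArtinSchreier.map (f : A →+* B) (a : A) : ArtinSchreier p a →+* ArtinSchreier p
    (f a) :=
  AdjoinRoot.map f _ _ (asPoly_map f a).symm.dvd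

theorem ArtinSchreier.map_mk (f : A →+* B) (a : A) (q : A[X]) :
    ArtinSchreier.map f a (AdjoinRoot.mk (asPoly p a) q) = AdjoinRoot.mk _ (q.map f) := by
  rw [map, AdjoinRoot.map, AdjoinRoot.lift_mk, ← eval₂_map, ← AdjoinRoot.algebraMap_eq,
    ← aeval_def, AdjoinRoot.aeval_eq]

theorem ArtinSchreier.map_of (f : A →+* B) (a x : A) :
    ArtinSchreier.map (p := p) f a (AdjoinRoot.of _ x) = AdjoinRoot.of _ (f x) :=
  (ArtinSchreier.map_mk f a (C x)).trans (by rw [map_C]; rfl)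

theorem ArtinSchreier.map_root (f : A →+* B) (a : A) :
    ArtinSchreier.map (p := p) f a (AdjoinRoot.root _) = AdjoinRoot.root _ :=
  (ArtinSchreier.map_mk f a X).trans (by rw [map_X]; rfl)

theorem ArtinSchreier.exists_degree_lt (b : B) (z : ArtinSchreier p b) :
    ∃ q : B[X], q.degree < (p : ℕ) ∧ AdjoinRoot.mk _ q = z := by
  obtain ⟨q, rfl⟩ := AdjoinRoot.mk_surjective z
  rcases subsingleton_or_nontrivial B with h | h
  · exact ⟨0, by simp, congrArg _ (Subsingleton.elim _ _)⟩
  refine ⟨q %ₘ asPoly p b, ?_, ?_⟩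
  · rw [← degree_asPoly b]
    exact degree_modByMonic_lt _ (asPoly_monic b)
  · rw [← AdjoinRoot.modByMonicHom_mk (asPoly_monic b)]
    exact AdjoinRoot.mk_leftInverse (asPoly_monic b) _

theorem ArtinSchreier.mk_injOn {b : B} {q r : B[X]} (hq : q.degree < (p : ℕ))
    (hr : r.degree < (p : ℕ)) (h : AdjoinRoot.mk (asPoly p b) q = AdjoinRoot.mk _ r) : q = r := by
  nontriviality B
  have h1 := congrArg (AdjoinRoot.modByMonicHom (asPoly_monic b)) h
  rw [← degree_asPoly b] at hq hr
  rwa [AdjoinRoot.modByMonicHom_mk, AdjoinRoot.modByMonicHom_mk,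
    (modByMonic_eq_self_iff (asPoly_monic b)).2 hq, (modByMonic_eq_self_iff (asPoly_monic b)).2 hr]
    at h1

instance [CharP B p] (b : B) : CharP (ArtinSchreier p b) p := by
  have := CharP.nontrivial_of_char_ne_one (R := B) hp.out.ne_one
  refine charP_of_injective_algebraMap (R := B) ((injective_iff_map_eq_zero _).2 fun c hc => ?_) p
  rw [AdjoinRoot.algebraMap_eq, ← AdjoinRoot.mk_C, ← map_zero (AdjoinRoot.mk _)] at hc
  have h0 : (0 : WithBot ℕ) < (p : ℕ) := by exact_mod_cast hp.out.pos
  simpa using ArtinSchreier.mk_injOn (lt_of_le_of_lt degree_C_le h0) (by simp) hc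

/-- Since x^p = x + b, the p-th power of q(x) is q with Frobenius applied to its coefficients,
evaluated at x + b. So Frobenius does not raise degrees and acts on the degree-d coefficient by c ↦
c^p, modulo terms of lower degree. -/
theorem ArtinSchreier.mk_pow [CharP B p] (b : B) (q : B[X]) :
    AdjoinRoot.mk (asPoly p b) q ^ p =
      AdjoinRoot.mk (asPoly p b) ((q.map (frobenius B p)).comp (X + C b)) := by
  rw [← map_pow, ← map_frobenius_expand, map_expand, expand_eq_comp_X_pow, ← AdjoinRoot.aeval_eq,
    ← AdjoinRoot.aeval_eq, aeval_comp, aeval_comp]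
  congr 2
  simpa [AdjoinRoot.algebraMap_eq] using ArtinSchreier.root_pow (p := p) b

theorem exists_eq_C_mul_X_pow_add {d : ℕ} {q : B[X]} (hq : q.degree < (d + 1 : ℕ)) :
    ∃ (c : B) (q' : B[X]), q'.degree < (d : ℕ) ∧ q = C c * X ^ d + q' := by
  refine ⟨q.coeff d, q - C (q.coeff d) * X ^ d, ?_, by ring⟩
  rw [degree_lt_iff_coeff_zero] at hq ⊢
  intro m hm
  rcases hm.eq_or_lt with rfl | hm
  · simp
  · rw [coeff_sub, hq m hm, coeff_C_mul_X_pow, if_neg (by omega), sub_zero]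

theorem degree_comp_X_add_C_lt {d : ℕ} {q : B[X]} (hq : q.degree < (d : ℕ)) (b : B) :
    (q.comp (X + C b)).degree < (d : ℕ) := by
  rwa [← taylor_apply, degree_taylor]

theorem degree_X_add_C_pow_sub_lt (d : ℕ) (b : B) :
    ((X + C b) ^ d - X ^ d : B[X]).degree < (d : ℕ) := by
  rw [degree_lt_iff_coeff_zero]
  intro m hm
  rw [coeff_sub, coeff_X_add_C_pow, coeff_X_pow]
  rcases hm.eq_or_lt with rfl | hm
  · simp
  · rw [Nat.choose_eq_zero_of_lt hm, if_neg hm.ne']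
    simp

/-- Filter the extension by the degree in the root. The operator y ↦ y^p - y respects this
filtration and induces c ↦ c^p - c on each graded piece, so both conditions follow from those for f
by peeling off leading coefficients. -/
theorem IsFrobeniusIso.artinSchreier [CharP A p] [CharP B p] {f : A →+* B}
    (hf : IsFrobeniusIso p f) (a : A) :
    IsFrobeniusIso p (ArtinSchreier.map (p := p) f a) where
  injective := by
    rw [injective_iff_map_eq_zero]
    intro z hz
    obtain ⟨q, hq, rfl⟩ := ArtinSchreier.exists_degree_lt a z
    rw [ArtinSchreier.map_mk, ← map_zero (AdjoinRoot.mk _)] at hz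
    have h0 := ArtinSchreier.mk_injOn (lt_of_le_of_lt degree_map_le hq)
      (by simp) hz
    rw [Polynomial.map_eq_zero_iff hf.injective] at h0
    rw [h0, map_zero]
  mem_range := by
    have key : ∀ d : ℕ, d ≤ p → ∀ q : B[X], q.degree < (d : ℕ) →
        AdjoinRoot.mk (asPoly p (f a)) q ^ p - AdjoinRoot.mk (asPoly p (f a)) q ∈
          (ArtinSchreier.map (p := p) f a).range →
        AdjoinRoot.mk (asPoly p (f a)) q ∈ (ArtinSchreier.map (p := p) f a).range := by
      intro d
      induction d with
      | zero =>
        intro _ q hq _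
        have : q = 0 := by simpa using hq
        rw [this, map_zero]
        exact Subring.zero_mem _
      | succ d ih =>
        intro hd q hq hr
        obtain ⟨c, q', hq', rfl⟩ := exists_eq_C_mul_X_pow_add hq
        have hc : c ∈ f.range := by
          obtain ⟨s, hs⟩ := hr
          obtain ⟨r, hr, rfl⟩ := ArtinSchreier.exists_degree_lt a s
          rw [ArtinSchreier.map_mk, ArtinSchreier.mk_pow, ← map_sub] at hs
          have h1 := ArtinSchreier.mk_injOn (lt_of_le_of_lt degree_map_le hr) ?_ hs
          · refine hf.mem_range c ⟨r.coeff d, ?_⟩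
            have h2 := congrArg (coeff · d) h1
            simp only [coeff_map] at h2
            have hd1 : ∀ r : B[X], r.degree < (d : ℕ) → r.coeff d = 0 := fun r hr =>
              coeff_eq_zero_of_degree_lt hr
            rw [h2, coeff_sub, Polynomial.map_add, add_comp, coeff_add, coeff_add, hd1 q' hq',
              hd1 _ (degree_comp_X_add_C_lt (lt_of_le_of_lt degree_map_le hq') _)]
            simp only [Polynomial.map_mul, map_C, Polynomial.map_pow, map_X, mul_comp, C_comp,
              pow_comp, X_comp, coeff_C_mul, coeff_X_add_C_pow, frobenius_def]
            simp
          · refine lt_of_lt_of_le (lt_of_le_of_lt (degree_sub_le _ _) (max_lt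
              (degree_comp_X_add_C_lt (lt_of_le_of_lt degree_map_le hq) _) hq)) ?_
            exact_mod_cast hd
        obtain ⟨a₀, rfl⟩ := hc
        have ht : AdjoinRoot.mk (asPoly p (f a)) (C (f a₀) * X ^ d) ∈
            (ArtinSchreier.map (p := p) f a).range :=
          ⟨AdjoinRoot.mk _ (C a₀ * X ^ d), by rw [ArtinSchreier.map_mk]; simp⟩
        rw [map_add]
        refine Subring.add_mem _ ht (ih (by omega) q' hq' ?_)
        rw [map_add, add_pow_char] at hr
        convert Subring.sub_mem _ hr (Subring.sub_mem _ (Subring.pow_mem _ ht p) ht) using 1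
        ring
    intro b hb
    obtain ⟨q, hq, rfl⟩ := ArtinSchreier.exists_degree_lt (f a) b
    exact key p le_rfl q hq hb
  exists_sub_mem := by
    have key : ∀ d : ℕ, d ≤ p → ∀ q : B[X], q.degree < (d : ℕ) →
        ∃ c, AdjoinRoot.mk (asPoly p (f a)) q - (c ^ p - c) ∈
          (ArtinSchreier.map (p := p) f a).range := by
      intro d
      induction d with
      | zero =>
        intro _ q hq
        have : q = 0 := by simpa using hq
        refine ⟨0, ?_⟩
        rw [this, map_zero, zero_pow hp.out.ne_zero]
        simp
      | succ d ih =>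
        intro hd q hq
        obtain ⟨c, q', hq', rfl⟩ := exists_eq_C_mul_X_pow_add hq
        obtain ⟨e, a₀, ha₀⟩ := hf.exists_sub_mem c
        -- The p-th power of e x^d is e^p (x + a)^d. Its terms below degree d are moved into the
        -- remainder before the induction hypothesis is applied.
        have hd' : (C (e ^ p) * ((X + C (f a)) ^ d - X ^ d) : B[X]).degree < ((d : ℕ) : WithBot ℕ) := by
          refine lt_of_le_of_lt (degree_mul_le _ _) (lt_of_le_of_lt
            (add_le_add_left degree_C_le _) ?_)
          rw [zero_add]
          exact degree_X_add_C_pow_sub_lt d _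
        obtain ⟨t, ht⟩ := ih (by omega) (q' - C (e ^ p) * ((X + C (f a)) ^ d - X ^ d))
          (lt_of_le_of_lt (degree_sub_le _ _) (max_lt hq' hd'))
        refine ⟨t + AdjoinRoot.mk _ (C e * X ^ d), ?_⟩
        have h1 : AdjoinRoot.mk (asPoly p (f a)) (C (f a₀) * X ^ d) ∈
            (ArtinSchreier.map (p := p) f a).range :=
          ⟨AdjoinRoot.mk _ (C a₀ * X ^ d), by rw [ArtinSchreier.map_mk]; simp⟩
        convert Subring.add_mem _ ht h1 using 1
        rw [add_pow_char, ArtinSchreier.mk_pow, ha₀]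
        simp only [Polynomial.map_mul, map_C, Polynomial.map_pow, map_X, mul_comp, C_comp,
          pow_comp, X_comp, map_add, map_sub, map_mul, frobenius_def, map_pow]
        ring
    intro b
    obtain ⟨q, hq, rfl⟩ := ArtinSchreier.exists_degree_lt (f a) b
    exact key p le_rfl q hq

end ArtinSchreier

end

/-! ### Artin–Schreier roots on geometric points; towers -/

section

open TensorProduct Limits Opposite PreGaloisCategory Polynomial

namespace EtaleCover

section ASPoints

variable {A : Type u} [CommRing A] {p : ℕ} [hp : Fact p.Prime] {Ω : Type u} [Field Ω]
  [CharP Ω p]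

theorem exists_natCast_of_pow_eq {x : Ω} (hx : x ^ p = x) : ∃ k : ℕ, x = k := by
  let _ := ZMod.algebra Ω p
  have h1 : x ∈ (⊥ : Subfield Ω) := (Subfield.mem_bot_iff_pow_eq_self Ω p).2 hx
  have h2 : (algebraMap (ZMod p) Ω).fieldRange = ⊥ := (Subfield.bot_eq_of_zMod_algebra p).symm
  rw [← h2] at h1
  obtain ⟨k, rfl⟩ := h1
  refine ⟨k.val, ?_⟩
  conv_lhs => rw [← ZMod.natCast_zmod_val k]
  rw [map_natCast]

theorem exists_eq_add_natCast {x y c : Ω} (hx : x ^ p = x + c) (hy : y ^ p = y + c) :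
    ∃ k : ℕ, y = x + k := by
  obtain ⟨k, hk⟩ := exists_natCast_of_pow_eq (p := p) (x := y - x) (by
    rw [sub_pow_char, hx, hy]; ring)
  exact ⟨k, by rw [← hk]; ring⟩

theorem natCast_pow_char {T : Type*} [CommRing T] [CharP T p] (k : ℕ) : (k : T) ^ p = k := by
  exact map_natCast (frobenius T p) k

variable [Algebra A Ω] [CharP A p]

theorem ArtinSchreier.root_pow_apply {T : Type*} [CommRing T] [Algebra A T] {a : A}
    (x : ArtinSchreier p a →ₐ[A] T) :
    x (AdjoinRoot.root _) ^ p = x (AdjoinRoot.root _) + algebraMap A T a := by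
  rw [← map_pow, ArtinSchreier.root_pow, map_add, AlgHom.commutes]

theorem exists_lift_apply {T : Type*} [CommRing T] [Algebra A T] {a : A} {z : T}
    (hz : z ^ p = z + algebraMap A T a) :
    ∃ g : ArtinSchreier p a →ₐ[A] T, g (AdjoinRoot.root _) = z :=
  ⟨ArtinSchreier.lift z hz, ArtinSchreier.lift_root z hz⟩

theorem ArtinSchreier.algHom_ext {T : Type*} [CommRing T] [Algebra A T] {a : A}
    {g h : ArtinSchreier p a →ₐ[A] T}
    (H : g (AdjoinRoot.root _) = h (AdjoinRoot.root _)) : g = h :=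
  AdjoinRoot.algHom_ext H

/-- The fundamental group does not move an Artin–Schreier root which lies in the base. -/
theorem smul_apply_eq_of_pow_eq {E : Type u} [CommRing E] [Algebra A E] [Module.Finite A E]
    [Algebra.Etale A E] {a : A} {z : E} (hz : z ^ p = z + algebraMap A E a) (γ : etalePi1 A Ω)
    (x : E →ₐ[A] Ω) {c : A} (hc : c ^ p = c + a) (k : ℕ) (h : x z = algebraMap A Ω c + k) :
    (γ • x) z = x z := by
  obtain ⟨g, hg⟩ := exists_lift_apply hz
  obtain ⟨s, hs⟩ := exists_lift_apply (T := A) (a := a) (z := c + k) (by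
    rw [add_pow_char, hc, natCast_pow_char, Algebra.algebraMap_self_apply]; ring)
  -- The root x z = c + k already lies in A, so the point factors through a section, and the
  -- fundamental group fixes the only point of the trivial cover.
  have h1 : x.comp g = (Algebra.ofId A Ω).comp s := ArtinSchreier.algHom_ext (by
    rw [AlgHom.comp_apply, AlgHom.comp_apply, hg, hs, h, map_add, map_natCast]; rfl)
  have h2 : γ • (Algebra.ofId A Ω).comp s = (Algebra.ofId A Ω).comp s := by
    rw [smul_comp]
    exact congrArg (AlgHom.comp · s) (Subsingleton.elim _ _)
  have h3 := DFunLike.congr_fun (smul_comp γ x g) (AdjoinRoot.root _)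
  rw [h1, h2, ← h1, AlgHom.comp_apply, AlgHom.comp_apply, hg] at h3
  exact h3.symm

/-- Roots of the equation are homomorphisms from an étale algebra, and these are determined by
geometric points. For arbitrary elements of E, nilpotents would obstruct this. -/
theorem eq_of_points_apply_eq [ConnectedSpace (PrimeSpectrum A)] [IsAlgClosed Ω] {E : Type u}
    [CommRing E] [Algebra A E]
    [Module.Finite A E] [Algebra.Etale A E] {a : A} {z w : E}
    (hz : z ^ p = z + algebraMap A E a) (hw : w ^ p = w + algebraMap A E a)
    (h : ∀ x : E →ₐ[A] Ω, x z = x w) : z = w := by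
  obtain ⟨g, rfl⟩ := exists_lift_apply hz
  obtain ⟨g', rfl⟩ := exists_lift_apply hw
  rw [algHom_ext_of_points Ω (f := g) (g := g') fun x => ArtinSchreier.algHom_ext (h x)]

/-- A cover with transitive monodromy is connected. -/
theorem connectedSpace_of_transitive (p : ℕ) [hp : Fact p.Prime] [CharP Ω p] [CharP A p]
    [ConnectedSpace (PrimeSpectrum A)] [IsAlgClosed Ω] {E : Type u} [CommRing E] [Algebra A E]
    [Module.Finite A E] [Algebra.Etale A E] (x : E →ₐ[A] Ω)
    (h : ∀ y : E →ₐ[A] Ω, ∃ γ : etalePi1 A Ω, γ • x = y) : ConnectedSpace (PrimeSpectrum E) := by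
  refine connectedSpace_primeSpectrum_iff.2 ⟨x.toRingHom.domain_nontrivial, fun e he => ?_⟩
  -- Idempotents are roots of the Artin–Schreier equation with constant 0, so the results on roots
  -- apply to them.
  have hidem : ∀ {T : Type u} [CommRing T] [Algebra A T] {t : T}, IsIdempotentElem t →
      t ^ p = t + algebraMap A T 0 := fun ht => by
    rw [map_zero, add_zero, ht.pow_eq hp.out.ne_zero]
  have h01 : x e = 0 ∨ x e = 1 := IsIdempotentElem.iff_eq_zero_or_one.1 (he.map x)
  have hy : ∀ y : E →ₐ[A] Ω, y e = x e := fun y => by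
    obtain ⟨γ, rfl⟩ := h y
    rcases h01 with h0 | h0
    · exact smul_apply_eq_of_pow_eq (hidem he) γ x (c := 0) (by simp [hp.out.ne_zero]) 0 (by simp [h0])
    · exact smul_apply_eq_of_pow_eq (hidem he) γ x (c := 1) (by simp) 0 (by simp [h0])
  rcases h01 with h0 | h0
  · exact Or.inl (eq_of_points_apply_eq (p := p) (Ω := Ω) (hidem he) (hidem IsIdempotentElem.zero) fun y => by
      rw [hy, h0, map_zero])
  · exact Or.inr (eq_of_points_apply_eq (p := p) (Ω := Ω) (hidem he) (hidem IsIdempotentElem.one) fun y => by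
      rw [hy, h0, map_one])

end ASPoints

section Exponent

variable {A : Type u} [CommRing A] {Ω : Type u} [Field Ω] [Algebra A Ω]

theorem isPTypical_iff {p : ℕ} {E : CommAlgCat.FiniteEtale.{u} A} :
    isPTypical A Ω p E ↔ ∀ γ : etalePi1 A Ω, ∃ k : ℕ, ∀ x : (etaleFibre A Ω).obj (op E),
      γ ^ p ^ k • x = x := by
  refine ⟨fun h γ => ?_, fun h => ?_⟩
  · obtain ⟨k, hk⟩ := h ⟨_, γ, rfl⟩
    refine ⟨k, fun x => ?_⟩
    rw [Subtype.ext_iff] at hk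
    simp only [SubmonoidClass.coe_pow, OneMemClass.coe_one, ← map_pow] at hk
    exact Equiv.congr_fun hk x
  · rintro ⟨_, γ, rfl⟩
    obtain ⟨k, hk⟩ := h γ
    refine ⟨k, ?_⟩
    rw [Subtype.ext_iff]
    simp only [SubmonoidClass.coe_pow, OneMemClass.coe_one, ← map_pow]
    exact Equiv.ext hk

/-- On a point x, δ acts as a deck transformation t adding some j of the prime field to the root.
Deck transformations commute with the monodromy action, so δ^n adds n j, and p j = 0. -/
theorem smul_tower {p : ℕ} [hp : Fact p.Prime] [CharP Ω p] [CharP A p] {E : Type u} [CommRing E]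
    [Algebra A E] [CharP E p]
    [Module.Finite A E] [Algebra.Etale A E] (e : E) [Module.Finite A (ArtinSchreier p e)]
    [Algebra.Etale A (ArtinSchreier p e)] (δ : etalePi1 A Ω) (hδ : ∀ x : E →ₐ[A] Ω, δ • x = x)
    (x : ArtinSchreier p e →ₐ[A] Ω) : δ ^ p • x = x := by
  let i : E →ₐ[A] ArtinSchreier p e := IsScalarTower.toAlgHom A E _
  let r : ArtinSchreier p e := AdjoinRoot.root _
  have hext : ∀ {y z : ArtinSchreier p e →ₐ[A] Ω}, y.comp i = z.comp i → y r = z r → y = z := by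
    intro y z h1 h2
    refine AlgHom.coe_ringHom_injective (AdjoinRoot.ringHom_ext ?_ h2)
    exact congrArg AlgHom.toRingHom h1
  have hr : ∀ y : ArtinSchreier p e →ₐ[A] Ω, y r ^ p = y r + y.comp i e := fun y => by
    rw [← map_pow, ArtinSchreier.root_pow, map_add]; rfl
  have hi : ∀ y : ArtinSchreier p e →ₐ[A] Ω, (δ • y).comp i = y.comp i := fun y => by
    rw [← smul_comp, hδ]
  obtain ⟨j, hj⟩ := exists_eq_add_natCast (hr x) ((hr (δ • x)).trans (by rw [hi]))
  obtain ⟨t, ht⟩ := exists_lift_apply (T := ArtinSchreier p e) (a := e) (z := r + j) (by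
    rw [add_pow_char, natCast_pow_char, ArtinSchreier.root_pow]; ring)
  have hti : (t.restrictScalars A).comp i = i := by
    ext a; exact t.commutes a
  have hn : ∀ n : ℕ, (δ ^ n • x).comp i = x.comp i ∧ (δ ^ n • x) r = x r + n * j := by
    intro n
    induction n with
    | zero => simp
    | succ n ih =>
      have h1 : δ • x = x.comp (t.restrictScalars A) := by
        refine hext ?_ ?_
        · rw [hi, AlgHom.comp_assoc, hti]
        · rw [hj, AlgHom.comp_apply, AlgHom.restrictScalars_apply, ht, map_add, map_natCast]
      have h2 : δ ^ (n + 1) • x = (δ ^ n • x).comp (t.restrictScalars A) := by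
        rw [pow_succ, mul_smul, h1, smul_comp]
      rw [h2]
      refine ⟨by rw [AlgHom.comp_assoc, hti, ih.1], ?_⟩
      rw [AlgHom.comp_apply, AlgHom.restrictScalars_apply, ht, map_add, ih.2, map_natCast]
      push_cast; ring
  refine hext (hn p).1 ?_
  rw [(hn p).2, CharP.cast_eq_zero, zero_mul, add_zero]

end Exponent

end EtaleCover

/-- An iterated Artin–Schreier extension of the source of `f : A → B`, with the corresponding
extension of `B`. -/
inductive ArtinSchreierTower (p : ℕ) [Fact p.Prime] {A B : Type u} [CommRing A] [CommRing B]
    (f : A →+* B) :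
    ∀ {E C : Type u} [CommRing E] [CommRing C], (A →+* E) → (B →+* C) → (E →+* C) → Prop
  | refl : ArtinSchreierTower p f (RingHom.id A) (RingHom.id B) f
  | step {E C : Type u} [CommRing E] [CommRing C] {i : A →+* E} {j : B →+* C} {φ : E →+* C} (e : E) :
      ArtinSchreierTower p f i j φ →
      ArtinSchreierTower p f ((AdjoinRoot.of (asPoly p e)).comp i)
        ((AdjoinRoot.of (asPoly p (φ e))).comp j) (ArtinSchreier.map φ e)

namespace ArtinSchreierTower

variable {p : ℕ} [hp : Fact p.Prime] {A B : Type u} [CommRing A] [CommRing B] [CharP A p] [CharP B p]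
  {f : A →+* B} {E C : Type u} [CommRing E] [CommRing C] {i : A →+* E} {j : B →+* C} {φ : E →+* C}

theorem charP (h : ArtinSchreierTower p f i j φ) : CharP E p ∧ CharP C p := by
  induction h with
  | refl => exact ⟨inferInstance, inferInstance⟩
  | step e _ ih =>
    obtain ⟨_, _⟩ := ih
    exact ⟨inferInstance, inferInstance⟩

theorem isFrobeniusIso (h : ArtinSchreierTower p f i j φ) (hf : IsFrobeniusIso p f) :
    IsFrobeniusIso p φ := by
  induction h with
  | refl => exact hf
  | step e h ih =>
    obtain ⟨_, _⟩ := h.charP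
    exact ih.artinSchreier e

theorem comp_eq (h : ArtinSchreierTower p f i j φ) : φ.comp i = j.comp f := by
  induction h with
  | refl => rfl
  | step e h ih =>
    ext a
    refine (ArtinSchreier.map_of _ _ _).trans ?_
    exact congrArg _ (DFunLike.congr_fun ih a)

/-- C is generated by B and the image of E, since every root adjoined on the B-side is the image of
one adjoined on the A-side. -/
theorem ringHom_ext (h : ArtinSchreierTower p f i j φ) {T : Type*} [CommRing T] {x y : C →+* T}
    (h1 : x.comp j = y.comp j) (h2 : x.comp φ = y.comp φ) : x = y := by
  induction h with
  | refl => exact h1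
  | step e h ih =>
    refine AdjoinRoot.ringHom_ext (ih h1 ?_) ?_
    · ext a
      have := DFunLike.congr_fun h2 (AdjoinRoot.of _ a)
      simpa [ArtinSchreier.map_of] using this
    · have := DFunLike.congr_fun h2 (AdjoinRoot.root _)
      simpa [ArtinSchreier.map_root] using this

theorem etale (h : ArtinSchreierTower p f i j φ) :
    (i.Finite ∧ i.Etale) ∧ (j.Finite ∧ j.Etale) := by
  induction h with
  | refl => exact ⟨⟨RingHom.Finite.id _, .of_bijective Function.bijective_id⟩,
      ⟨RingHom.Finite.id _, .of_bijective Function.bijective_id⟩⟩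
  | step e h ih =>
    obtain ⟨_, _⟩ := h.charP
    have h1 : ∀ {S : Type u} [CommRing S] [CharP S p] (s : S),
        (AdjoinRoot.of (asPoly p s)).Finite ∧ (AdjoinRoot.of (asPoly p s)).Etale := fun s =>
      ⟨RingHom.finite_algebraMap.2 inferInstance, (RingHom.etale_algebraMap).2 inferInstance⟩
    exact ⟨⟨(h1 _).1.comp ih.1.1, RingHom.Etale.stableUnderComposition _ _ ih.1.2 (h1 _).2⟩,
      ⟨(h1 _).1.comp ih.2.1, RingHom.Etale.stableUnderComposition _ _ ih.2.2 (h1 _).2⟩⟩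

variable {Ω : Type u} [Field Ω]

theorem exists_pow_smul_eq_step [CharP Ω p] [Algebra A Ω] [CharP E p]
    (h : ∀ [Algebra A E] [Module.Finite A E] [Algebra.Etale A E], algebraMap A E = i →
      ∀ γ : etalePi1 A Ω, ∃ k : ℕ, ∀ x : E →ₐ[A] Ω, γ ^ p ^ k • x = x) (hi : i.Finite) (hi' : i.Etale)
    (e : E) [inst : Algebra A (ArtinSchreier p e)] [Module.Finite A (ArtinSchreier p e)]
    [Algebra.Etale A (ArtinSchreier p e)]
    (he : algebraMap A (ArtinSchreier p e) = (AdjoinRoot.of (asPoly p e)).comp i)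
    (γ : etalePi1 A Ω) : ∃ k : ℕ, ∀ x : ArtinSchreier p e →ₐ[A] Ω, γ ^ p ^ k • x = x := by
  let _ := i.toAlgebra
  have : Module.Finite A E := hi
  have : Algebra.Etale A E := hi'
  -- The A-algebra structure is arbitrary apart from its structure map, which determines it.
  obtain rfl : inst = AdjoinRoot.instAlgebra _ := Algebra.algebra_ext _ _ fun a =>
    DFunLike.congr_fun he a
  obtain ⟨k, hk⟩ := h rfl γ
  refine ⟨k + 1, fun x => ?_⟩
  rw [pow_succ, pow_mul]
  exact EtaleCover.smul_tower e _ hk x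

/-- By `smul_tower` each storey costs at most one more factor p in the order of γ, so both covers of
a tower are p-typical. -/
theorem exists_pow_smul_eq [CharP Ω p] [Algebra A Ω] [Algebra B Ω]
    (h : ArtinSchreierTower p f i j φ) :
    (∀ [Algebra A E] [Module.Finite A E] [Algebra.Etale A E], algebraMap A E = i →
      ∀ γ : etalePi1 A Ω, ∃ k : ℕ, ∀ x : E →ₐ[A] Ω, γ ^ p ^ k • x = x) ∧
    (∀ [Algebra B C] [Module.Finite B C] [Algebra.Etale B C], algebraMap B C = j →
      ∀ γ : etalePi1 B Ω, ∃ k : ℕ, ∀ x : C →ₐ[B] Ω, γ ^ p ^ k • x = x) := by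
  induction h with
  | refl =>
    have h1 : ∀ {A : Type u} [CommRing A] [Algebra A Ω] [Algebra A A],
        algebraMap A A = RingHom.id A → ∀ x y : A →ₐ[A] Ω, x = y := fun h x y => by
      ext a
      have := (x.commutes a).trans (y.commutes a).symm
      rwa [h] at this
    exact ⟨fun h _ => ⟨0, fun _ => h1 h _ _⟩, fun h _ => ⟨0, fun _ => h1 h _ _⟩⟩
  | step e h ih =>
    obtain ⟨_, _⟩ := h.charP
    obtain ⟨⟨h1, h2⟩, ⟨h3, h4⟩⟩ := h.etale
    exact ⟨fun he γ => exists_pow_smul_eq_step ih.1 h1 h2 e he γ,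
      fun he γ => exists_pow_smul_eq_step ih.2 h3 h4 _ he γ⟩

end ArtinSchreierTower

end

/-! ### Characters of p-groups, the p-typical action and base change -/

section

open TensorProduct Limits Opposite PreGaloisCategory Polynomial

namespace EtaleCover

section Group

/-- A proper subgroup of a finite `p`-group is killed by a nontrivial character of order `p`. -/
theorem exists_character {p : ℕ} [hp : Fact p.Prime] {G Q : Type*} [Group G] [Group Q] [Finite Q]
    (ψ : G →* Q) (hψ : IsPGroup p ψ.range) (H : Subgroup Q) (hH : H < ψ.range) :
    ∃ χ : G →* Multiplicative (ZMod p), Function.Surjective χ ∧ ∀ γ, ψ γ ∈ H → χ γ = 1 := by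
  obtain ⟨m, hm⟩ := hψ.exists_card_eq
  obtain ⟨n, hn⟩ := (hψ.to_subgroup (H.subgroupOf ψ.range)).exists_card_eq
  have hlt : p ^ n < p ^ m := by
    rw [← hm, ← hn]
    refine lt_of_le_of_ne (Subgroup.card_le_card_group _) fun h => ?_
    have h2 := (Subgroup.card_eq_iff_eq_top _).1 h
    exact hH.not_ge (Subgroup.subgroupOf_eq_top.1 h2)
  have hnm : n < m := (Nat.pow_lt_pow_iff_right hp.out.one_lt).1 hlt
  obtain ⟨m, rfl⟩ : ∃ k, m = k + 1 := ⟨m - 1, by omega⟩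
  -- H is enlarged to a subgroup of index p, which is normal because p is the smallest prime factor
  -- of the order.
  obtain ⟨K, hK, hHK⟩ := Sylow.exists_subgroup_card_pow_prime_le p (m := m)
    (hm ▸ pow_dvd_pow p m.le_succ) _ hn (by omega)
  have hindex : K.index = p := by
    have := K.card_mul_index
    rw [hK, hm, pow_succ] at this
    exact Nat.eq_of_mul_eq_mul_left (pow_pos hp.out.pos m) this
  have : K.Normal := Subgroup.normal_of_index_eq_minFac_card (by
    rw [hindex, hm, hp.out.pow_minFac m.succ_ne_zero])
  let e : (ψ.range ⧸ K) ≃* Multiplicative (ZMod p) :=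
    mulEquivOfPrimeCardEq (p := p) hindex (Nat.card_zmod p)
  refine ⟨e.toMonoidHom.comp ((QuotientGroup.mk' K).comp ψ.rangeRestrict), ?_, fun γ hγ => ?_⟩
  · exact e.surjective.comp ((QuotientGroup.mk'_surjective K).comp ψ.rangeRestrict_surjective)
  · have : (QuotientGroup.mk' K) (ψ.rangeRestrict γ) = 1 :=
      (QuotientGroup.eq_one_iff _).2 (hHK hγ)
    exact (congrArg e this).trans (map_one e)

end Group

section PTypicalAction

variable {A : Type u} [CommRing A] {Ω : Type u} [Field Ω] [Algebra A Ω] {p : ℕ}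

/-- The action of the `p`-typical fundamental group on the points of a `p`-typical cover. -/
def pSmul (δ : pTypicalPi1 A Ω p) {E : Type u} [CommRing E] [Algebra A E]
    [Module.Finite A E] [Algebra.Etale A E] (hE : isPTypical A Ω p (.of A E)) (x : E →ₐ[A] Ω) :
    E →ₐ[A] Ω :=
  δ.hom.app (op ⟨.of A E, hE⟩) x

theorem pSmul_comp (δ : pTypicalPi1 A Ω p) {E E' : Type u} [CommRing E] [Algebra A E]
    [Module.Finite A E] [Algebra.Etale A E] [CommRing E'] [Algebra A E']
    [Module.Finite A E'] [Algebra.Etale A E'] (hE : isPTypical A Ω p (.of A E))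
    (hE' : isPTypical A Ω p (.of A E')) (x : E' →ₐ[A] Ω) (f : E →ₐ[A] E') :
    pSmul δ hE (x.comp f) = (pSmul δ hE' x).comp f :=
  ConcreteCategory.congr_hom (δ.hom.naturality
    (X := op ⟨CommAlgCat.FiniteEtale.of A E', hE'⟩) (Y := op ⟨CommAlgCat.FiniteEtale.of A E, hE⟩)
    (Quiver.Hom.op ⟨(homMk (X := mk E') (Y := mk E) f).unop⟩)) x

theorem pTypicalPi1_ext {δ δ' : pTypicalPi1 A Ω p}
    (h : ∀ (E : Type u) [CommRing E] [Algebra A E] [Module.Finite A E] [Algebra.Etale A E]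
      (hE : isPTypical A Ω p (.of A E)) (x : E →ₐ[A] Ω), pSmul δ hE x = pSmul δ' hE x) : δ = δ' := by
  refine Iso.ext (NatTrans.ext (funext fun X => FintypeCat.hom_ext _ _ fun x => ?_))
  exact h X.unop.obj X.unop.property x

/-- The restriction map from the fundamental group to the `p`-typical fundamental group. -/
noncomputable def restrictPTypical (A : Type u) [CommRing A] (Ω : Type u) [Field Ω] [Algebra A Ω]
    (p : ℕ) :
    etalePi1 A Ω →* pTypicalPi1 A Ω p :=
  ((Functor.whiskeringLeft _ _ FintypeCat.{u}).obj (isPTypical A Ω p).ι.op).mapAut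
    (etaleFibre A Ω)

theorem isClopen_setOf_hom_app_eq {𝒞 : Type*} [Category* 𝒞] (F : 𝒞 ⥤ FintypeCat.{u}) {X : 𝒞}
    (x y : F.obj X) : IsClopen {γ : Aut F | γ.hom.app X x = y} := by
  have h : Continuous fun γ : Aut F => γ • x := continuous_id.smul continuous_const
  exact (isClopen_discrete {y}).preimage h

theorem isClopen_setOf_smul_eq {E : Type u} [CommRing E] [Algebra A E]
    [Module.Finite A E] [Algebra.Etale A E] (x y : E →ₐ[A] Ω) :
    IsClopen {γ : etalePi1 A Ω | γ • x = y} :=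
  isClopen_setOf_hom_app_eq (etaleFibre A Ω) (X := mk E) x y

theorem isClopen_setOf_pSmul_eq {E : Type u} [CommRing E] [Algebra A E]
    [Module.Finite A E] [Algebra.Etale A E] (hE : isPTypical A Ω p (.of A E)) (x y : E →ₐ[A] Ω) :
    IsClopen {δ : pTypicalPi1 A Ω p | pSmul δ hE x = y} :=
  isClopen_setOf_hom_app_eq (pTypicalFibre A Ω p) (X := op ⟨.of A E, hE⟩) x y

end PTypicalAction

section BaseChange

variable {A B : Type u} [CommRing A] [CommRing B] {Ω : Type u} [Field Ω] [Algebra A Ω]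
  [Algebra A B] [Algebra B Ω] [IsScalarTower A B Ω]
  {E C : Type u} [CommRing E] [Algebra A E] [Module.Finite A E] [Algebra.Etale A E]
  [CommRing C] [Algebra B C] [Module.Finite B C] [Algebra.Etale B C]

/-- The point of `B ⊗ E` over `B` given by a point of `E` over `A`. -/
noncomputable def liftPoint (B : Type u) [CommRing B] [Algebra A B] [Algebra B Ω]
    [IsScalarTower A B Ω]
    (x : E →ₐ[A] Ω) : B ⊗[A] E →ₐ[B] Ω :=
  Algebra.TensorProduct.lift (Algebra.ofId B Ω) x fun _ _ => Commute.all _ _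

/-- By naturality along g, the action over B on points of B ⊗ E can be computed on any B-cover C
receiving E. This avoids identifying C with the base change. -/
theorem exists_comp_eq_liftPoint (x : E →ₐ[A] Ω) (y : C →ₐ[B] Ω) (h : E →+* C)
    (hc : ∀ a, h (algebraMap A E a) = algebraMap B C (algebraMap A B a))
    (hx : ∀ e, y (h e) = x e) :
    ∃ g : B ⊗[A] E →ₐ[B] C, (∀ e, g (1 ⊗ₜ e) = h e) ∧ y.comp g = liftPoint B x := by
  let _ := Algebra.compHom C (algebraMap A B)
  have : IsScalarTower A B C := .of_algebraMap_eq fun _ => rfl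
  let h' : E →ₐ[A] C := { h with commutes' := hc }
  refine ⟨Algebra.TensorProduct.lift (Algebra.ofId B C) h' fun _ _ => Commute.all _ _, fun e => ?_, ?_⟩
  · simp [h']
  · ext e
    simp [liftPoint, h', hx]

theorem etalePi1Map_smul (γ : etalePi1 B Ω) (x : E →ₐ[A] Ω) (e : E) :
    (etalePi1Map A Ω B γ • x) e = (γ • liftPoint B x) (1 ⊗ₜ e) := rfl

theorem etalePi1Map_smul_apply (γ : etalePi1 B Ω) (x : E →ₐ[A] Ω) (y : C →ₐ[B] Ω) (h : E →+* C)
    (hc : ∀ a, h (algebraMap A E a) = algebraMap B C (algebraMap A B a))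
    (hx : ∀ e, y (h e) = x e) (e : E) :
    (etalePi1Map A Ω B γ • x) e = (γ • y) (h e) := by
  obtain ⟨g, hg, hg'⟩ := exists_comp_eq_liftPoint x y h hc hx
  rw [etalePi1Map_smul, ← hg', smul_comp, AlgHom.comp_apply, hg]

theorem pTypicalPi1Map_pSmul_apply {p : ℕ} (δ : pTypicalPi1 B Ω p)
    (hE : isPTypical A Ω p (.of A E)) (hC : isPTypical B Ω p (.of B C))
    (x : E →ₐ[A] Ω) (y : C →ₐ[B] Ω) (h : E →+* C)
    (hc : ∀ a, h (algebraMap A E a) = algebraMap B C (algebraMap A B a))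
    (hx : ∀ e, y (h e) = x e) (e : E) :
    (pSmul (pTypicalPi1Map A Ω B p δ) hE x) e = (pSmul δ hC y) (h e) := by
  obtain ⟨g, hg, hg'⟩ := exists_comp_eq_liftPoint x y h hc hx
  have hBE : isPTypical B Ω p (.of B (B ⊗[A] E)) := isPTypical_baseChange A Ω B p _ hE
  have h1 : (pSmul (pTypicalPi1Map A Ω B p δ) hE x) e =
    (pSmul δ hBE (liftPoint B x)) (1 ⊗ₜ e) := rfl
  rw [h1, ← hg', pSmul_comp δ _ hC, AlgHom.comp_apply, hg]

end BaseChange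

end EtaleCover

end

/-! ### Bijectivity of the map of p-typical fundamental groups -/

section

open TensorProduct Limits Opposite PreGaloisCategory Polynomial

namespace EtaleCover

theorem charP_of_algebra (A T : Type*) [CommRing A] [CommRing T] [Algebra A T] [Nontrivial T]
    (p : ℕ)
    [hp : Fact p.Prime] [CharP A p] : CharP T p :=
  ringChar.of_eq (CharP.ringChar_of_prime_eq_zero hp.out (by
    rw [← map_natCast (algebraMap A T), CharP.cast_eq_zero, map_zero]))

section Surjectivity

variable {A : Type u} [CommRing A] {Ω : Type u} [Field Ω] [Algebra A Ω] {p : ℕ}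

theorem isOpen_setOf_apply_eq_one {E : Type u} [CommRing E] [Algebra A E] [Module.Finite A E]
    [Algebra.Etale A E] [Finite (E →ₐ[A] Ω)] {M : Type*} [Group M] (χ : etalePi1 A Ω →* M)
    (h : ∀ γ, (∀ x : E →ₐ[A] Ω, γ • x = x) → χ γ = 1) : IsOpen {γ | χ γ = 1} := by
  refine χ.ker.isOpen_of_mem_nhds (g := 1) (Filter.mem_of_superset
    ((isOpen_iInter_of_finite fun x : E →ₐ[A] Ω => (isClopen_setOf_smul_eq x x).isOpen).mem_nhds
      (Set.mem_iInter.2 fun x => one_smul _ x)) fun γ hγ => ?_)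
  exact h γ (Set.mem_iInter.1 hγ)

variable [ConnectedSpace (PrimeSpectrum A)] [IsAlgClosed Ω]

/-- The connected component of x is a subcover, hence again p-typical, and the full fundamental
group is transitive on its fibre. -/
theorem exists_smul_eq_pSmul (δ : pTypicalPi1 A Ω p) {E : Type u} [CommRing E] [Algebra A E]
    [Module.Finite A E] [Algebra.Etale A E] (hE : isPTypical A Ω p (.of A E)) (x : E →ₐ[A] Ω) :
    ∃ γ : etalePi1 A Ω, γ • x = pSmul δ hE x := by
  obtain ⟨Y, i, y, hy, hconn, hmono⟩ := fiber_in_connected_component (etaleFibre A Ω) (mk E) x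
  have hinj : Function.Injective ((etaleFibre A Ω).map i) :=
    ConcreteCategory.injective_of_mono_of_preservesPullback _
  have hY : isPTypical A Ω p Y.unop := isPTypical_iff.2 fun γ => by
    obtain ⟨k, hk⟩ := isPTypical_iff.1 hE γ
    exact ⟨k, fun t => hinj ((mulAction_naturality _ _ i t).symm.trans (hk _))⟩
  let C : Type u := Y.unop.obj
  let y' : C →ₐ[A] Ω := y
  have hx : y'.comp (algHom i) = x := hy
  obtain ⟨γ, hγ⟩ := MulAction.exists_smul_eq (etalePi1 A Ω) (y : (etaleFibre A Ω).obj Y)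
    (pSmul δ (E := C) hY y')
  refine ⟨γ, ?_⟩
  rw [← hx, pSmul_comp δ hE (E' := C) hY, smul_comp]
  exact congrArg (fun t : C →ₐ[A] Ω => t.comp (algHom i)) hγ

variable {B : Type u} [CommRing B] [ConnectedSpace (PrimeSpectrum B)] [Algebra A B] [Algebra B Ω]
  [IsScalarTower A B Ω] [hp : Fact p.Prime] [CharP A p] [CharP B p] [CharP Ω p]

theorem eq_one_of_natCast_val_eq_zero {c : Multiplicative (ZMod p)}
    (h : ((Multiplicative.toAdd c).val : Ω) = 0) : c = 1 := by
  rw [CharP.cast_eq_zero_iff Ω p] at h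
  exact toAdd_eq_zero.1 ((ZMod.val_eq_zero _).1 (Nat.eq_zero_of_dvd_of_lt h (ZMod.val_lt _)))

/-- Over the target of an `IsFrobeniusIso` homomorphism, the fundamental group has the same image in
the monodromy group of a `p`-typical cover. -/
theorem exists_etalePi1Map_smul_eq (hf : IsFrobeniusIso p (algebraMap A B)) {E : Type u}
    [CommRing E]
    [Algebra A E] [Module.Finite A E] [Algebra.Etale A E] (hE : isPTypical A Ω p (.of A E))
    (γ : etalePi1 A Ω) :
    ∃ β : etalePi1 B Ω, ∀ x : E →ₐ[A] Ω, etalePi1Map A Ω B β • x = γ • x := by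
  have hfin : Finite (E →ₐ[A] Ω) := finite_points A E Ω
  let ψ : etalePi1 A Ω →* Equiv.Perm (E →ₐ[A] Ω) := MulAction.toPermHom _ _
  let H := (ψ.comp (etalePi1Map A Ω B)).range
  have hle : H ≤ ψ.range := by
    rintro _ ⟨β, rfl⟩
    exact ⟨_, rfl⟩
  rcases hle.eq_or_lt with heq | hlt
  · obtain ⟨β, hβ⟩ : ψ γ ∈ H := heq ▸ ⟨γ, rfl⟩
    exact ⟨β, fun x => Equiv.congr_fun hβ x⟩
  -- The remaining case is contradictory: χ is a nontrivial character of π₁(A) that is trivial on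
  -- the image of π₁(B).
  obtain ⟨χ, hχ, hχH⟩ := exists_character ψ hE H hlt
  obtain ⟨E', _, _, _, _, x₀, z, a, hz, hzx⟩ := exists_artinSchreier_of_character χ
    (isOpen_setOf_apply_eq_one (E := E) χ fun γ hγ => hχH γ (by
      rw [show ψ γ = 1 from Equiv.ext hγ]; exact H.one_mem))
  rw [sub_eq_iff_eq_add'] at hz
  obtain ⟨g, hg⟩ := exists_lift_apply hz
  have hω : x₀ z ^ p = x₀ z + algebraMap A Ω a := by rw [← map_pow, hz, map_add, x₀.commutes]
  obtain ⟨y, hy⟩ := exists_lift_apply (A := B) (T := Ω) (a := algebraMap A B a) (z := x₀ z) (by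
    rw [hω, IsScalarTower.algebraMap_apply A B Ω])
  have hfix : ∀ β : etalePi1 B Ω, β • y = y := fun β => by
    refine ArtinSchreier.algHom_ext ?_
    have h1 := etalePi1Map_smul_apply β (x₀.comp g) y (ArtinSchreier.map (algebraMap A B) a)
      (ArtinSchreier.map_of _ _) (fun e => by
        have h2 : y.toRingHom.comp (ArtinSchreier.map (algebraMap A B) a) = (x₀.comp g).toRingHom := by
          refine AdjoinRoot.ringHom_ext ?_ ?_
          · ext c
            change y (ArtinSchreier.map (p := p) (algebraMap A B) a (AdjoinRoot.of _ c)) =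
              (x₀.comp g) (algebraMap A _ c)
            rw [ArtinSchreier.map_of, AlgHom.commutes, IsScalarTower.algebraMap_apply A B Ω]
            exact y.commutes _
          · change y (ArtinSchreier.map (p := p) (algebraMap A B) a (AdjoinRoot.root _)) =
              (x₀.comp g) (AdjoinRoot.root _)
            rw [ArtinSchreier.map_root, hy, AlgHom.comp_apply, hg]
        exact DFunLike.congr_fun h2 e) (AdjoinRoot.root _)
    rw [ArtinSchreier.map_root, smul_comp, AlgHom.comp_apply, hg, hzx, hχH _ ⟨β, rfl⟩] at h1
    rw [← h1, hy, toAdd_one, ZMod.val_zero, Nat.cast_zero, add_zero]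
  -- As π₁(B) fixes a root, the equation is solvable in B, hence in A by `hf.mem_range`; then π₁(A)
  -- fixes the root as well and χ is trivial.
  obtain ⟨s, hs⟩ := exists_section_of_fixed y hfix
  have hb := ArtinSchreier.root_pow_apply s
  obtain ⟨a', ha'⟩ := hf.mem_range (s (AdjoinRoot.root _)) ⟨a, by rw [hb]; simp⟩
  rw [← ha', ← map_pow, Algebra.algebraMap_self_apply, ← map_add] at hb
  replace hb := hf.injective hb
  obtain ⟨k, hk⟩ := exists_eq_add_natCast (p := p) (x := algebraMap A Ω a') (y := x₀ z)
    (c := algebraMap A Ω a) (by rw [← map_pow, hb, map_add]) hω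
  obtain ⟨γ', hγ'⟩ := hχ (Multiplicative.ofAdd 1)
  have h1 := smul_apply_eq_of_pow_eq hz γ' x₀ hb k hk
  rw [hzx, add_eq_left] at h1
  have h2 := eq_one_of_natCast_val_eq_zero h1
  rw [hγ', ofAdd_eq_one] at h2
  exact absurd h2 one_ne_zero

theorem isPTypical_tensorProduct {E E' : Type u} [CommRing E] [Algebra A E] [Module.Finite A E]
    [Algebra.Etale A E] [CommRing E'] [Algebra A E'] [Module.Finite A E'] [Algebra.Etale A E']
    [Module.Finite A (E ⊗[A] E')] [Algebra.Etale A (E ⊗[A] E')]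
    (hE : isPTypical A Ω p (.of A E)) (hE' : isPTypical A Ω p (.of A E')) :
    isPTypical A Ω p (.of A (E ⊗[A] E')) := by
  refine isPTypical_iff.2 fun γ => ?_
  obtain ⟨k, hk⟩ := isPTypical_iff.1 hE γ
  obtain ⟨k', hk'⟩ := isPTypical_iff.1 hE' γ
  have h1 : ∀ x : E →ₐ[A] Ω, γ ^ p ^ (k + k') • x = x := fun x => by
    rw [pow_add, pow_mul]
    exact (MulAction.stabilizer (etalePi1 A Ω) x).pow_mem (hk x) _
  have h2 : ∀ x : E' →ₐ[A] Ω, γ ^ p ^ (k + k') • x = x := fun x => by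
    rw [add_comm, pow_add, pow_mul]
    exact (MulAction.stabilizer (etalePi1 A Ω) x).pow_mem (hk' x) _
  refine ⟨k + k', fun x => ?_⟩
  let x' : E ⊗[A] E' →ₐ[A] Ω := x
  change γ ^ p ^ (k + k') • x' = x'
  refine Algebra.TensorProduct.ext ?_ ?_
  · change (γ ^ p ^ (k + k') • x').comp Algebra.TensorProduct.includeLeft = _
    rw [← smul_comp, h1]
  · change (γ ^ p ^ (k + k') • x').comp Algebra.TensorProduct.includeRight = _
    rw [← smul_comp, h2]; rfl

/-- For a p-typical cover with a chosen point, the elements of π₁(B) acting on that point as δ form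
a nonempty closed set. These sets are directed, and compactness gives an element in all of them. -/
theorem pTypicalPi1Map_surjective (hf : IsFrobeniusIso p (algebraMap A B)) :
    Function.Surjective (pTypicalPi1Map A Ω B p) := by
  intro δ
  let ι := Σ E : PTypicalCover A Ω p, ((E.obj.obj : Type u) →ₐ[A] Ω)
  let K : ι → Set (etalePi1 B Ω) := fun q =>
    {β | etalePi1Map A Ω B β • q.2 = pSmul δ (E := q.1.obj.obj) q.1.property q.2}
  have hne : ∀ q, (K q).Nonempty := fun q => by
    obtain ⟨γ, hγ⟩ := exists_smul_eq_pSmul δ (E := q.1.obj.obj) q.1.property q.2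
    obtain ⟨β, hβ⟩ := exists_etalePi1Map_smul_eq hf (E := q.1.obj.obj) q.1.property γ
    exact ⟨β, (hβ _).trans hγ⟩
  have hcl : ∀ q, IsClosed (K q) := fun q => by
    have : K q = {β | β • liftPoint B q.2 =
      liftPoint B (pSmul δ (E := q.1.obj.obj) q.1.property q.2)} := by
      ext β
      refine ⟨fun h => Algebra.TensorProduct.ext (Subsingleton.elim _ _) (AlgHom.ext fun e => ?_),
        fun h => AlgHom.ext fun e => ?_⟩
      · refine (DFunLike.congr_fun h e).trans ?_
        simp [liftPoint]
      · refine (DFunLike.congr_fun h (1 ⊗ₜ e)).trans ?_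
        simp [liftPoint]
    rw [this]
    exact (isClopen_setOf_smul_eq _ _).isClosed
  have hdir : Directed (· ⊇ ·) K := by
    rintro ⟨⟨E, hE⟩, x⟩ ⟨⟨E', hE'⟩, x'⟩
    -- The fibre product of two pointed covers dominates both, and agreeing with δ at its point
    -- implies agreement at both images.
    let T : Type u := (E.obj : Type u) ⊗[A] (E'.obj : Type u)
    have : Module.Finite A T := Module.Finite.trans E.obj _
    have : Algebra.Etale A T := Algebra.Etale.comp A E.obj _
    have hT : isPTypical A Ω p (.of A T) := isPTypical_tensorProduct hE hE'
    let t : T →ₐ[A] Ω := Algebra.TensorProduct.lift x x' fun _ _ => Commute.all _ _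
    have hx : t.comp Algebra.TensorProduct.includeLeft = x :=
      Algebra.TensorProduct.lift_comp_includeLeft ..
    have hx' : t.comp Algebra.TensorProduct.includeRight = x' :=
      Algebra.TensorProduct.lift_comp_includeRight x x' fun _ _ => Commute.all _ _
    refine ⟨⟨⟨.of A T, hT⟩, t⟩, fun β hβ => ?_, fun β hβ => ?_⟩
    · change etalePi1Map A Ω B β • x = pSmul δ (E := E.obj) hE x
      rw [← hx, smul_comp, pSmul_comp δ (E := E.obj) hE hT]
      exact congrArg (AlgHom.comp · _) hβ
    · change etalePi1Map A Ω B β • x' = pSmul δ (E := E'.obj) hE' x'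
      rw [← hx', smul_comp, pSmul_comp δ (E := E'.obj) hE' hT]
      exact congrArg (AlgHom.comp · _) hβ
  have hι : Nonempty ι := ⟨⟨⟨.of A A, isPTypical_iff.2 fun γ =>
    ⟨0, fun x => Subsingleton.elim (α := A →ₐ[A] Ω) _ _⟩⟩, Algebra.ofId A Ω⟩⟩
  obtain ⟨β, hβ⟩ := IsCompact.nonempty_iInter_of_directed_nonempty_isCompact_isClosed K hdir hne
    (fun q => (hcl q).isCompact) hcl
  rw [Set.mem_iInter] at hβ
  refine ⟨restrictPTypical B Ω p β, pTypicalPi1_ext fun E _ _ _ _ hE x => ?_⟩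
  exact hβ ⟨⟨.of A E, hE⟩, x⟩

end Surjectivity

section Injectivity

variable {A B : Type u} [CommRing A] [CommRing B] {Ω : Type u} [Field Ω] [IsAlgClosed Ω]
  [Algebra B Ω] {p : ℕ} [hp : Fact p.Prime] [CharP A p] [CharP B p] [CharP Ω p]

theorem etalePi1Map_etalePi1Map_smul {C C' : Type u} [CommRing C] [CommRing C'] [Algebra B C]
    [Algebra C C'] [Algebra B C'] [IsScalarTower B C C'] [Algebra C Ω] [Algebra C' Ω]
    [IsScalarTower B C Ω] [IsScalarTower C C' Ω] [IsScalarTower B C' Ω]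
    {Y : Type u} [CommRing Y] [Algebra B Y] [Module.Finite B Y] [Algebra.Etale B Y]
    (γ : etalePi1 C' Ω) (x : Y →ₐ[B] Ω) :
    etalePi1Map B Ω C (etalePi1Map C Ω C' γ) • x = etalePi1Map B Ω C' γ • x := by
  ext e
  symm
  refine etalePi1Map_smul_apply γ x (liftPoint C' (liftPoint C x))
    (((Algebra.TensorProduct.includeRight : C ⊗[B] Y →ₐ[C] C' ⊗[C] (C ⊗[B] Y)).toRingHom).comp
      (Algebra.TensorProduct.includeRight : Y →ₐ[B] C ⊗[B] Y).toRingHom) (fun b => ?_) (fun e => ?_) e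
  · change (1 : C') ⊗ₜ[C] ((1 : C) ⊗ₜ[B] algebraMap B Y b) = algebraMap B C' b ⊗ₜ 1
    rw [IsScalarTower.algebraMap_apply B C C', Algebra.algebraMap_eq_smul_one (A := Y),
      ← TensorProduct.smul_tmul, ← Algebra.algebraMap_eq_smul_one,
      ← mul_one (algebraMap B C b), ← smul_eq_mul, ← TensorProduct.smul_tmul',
      ← TensorProduct.smul_tmul, ← Algebra.algebraMap_eq_smul_one, smul_eq_mul, mul_one]
    rfl
  · change liftPoint C' (liftPoint C x) (1 ⊗ₜ (1 ⊗ₜ e)) = x e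
    simp [liftPoint]

/-- Every `p`-typical cover of the target of an `IsFrobeniusIso` homomorphism is dominated by an
iterated Artin–Schreier cover which comes from the source. -/
theorem exists_tower_of_isPTypical [ConnectedSpace (PrimeSpectrum B)] {f : A →+* B}
    (hf : IsFrobeniusIso p f) {Y : Type u} [CommRing Y]
    [Algebra B Y] [Module.Finite B Y] [Algebra.Etale B Y] (hY : isPTypical B Ω p (.of B Y))
    (y : Y →ₐ[B] Ω) :
    ∃ (E C : Type u) (_ : CommRing E) (_ : CommRing C) (i : A →+* E) (j : B →+* C) (φ : E →+* C),
      ArtinSchreierTower p f i j φ ∧ ∃ (c : C →+* Ω) (h : Y →+* C), c.comp j = algebraMap B Ω ∧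
        h.comp (algebraMap B Y) = j ∧ c.comp h = y.toRingHom := by
  have hfin : Finite (Y →ₐ[B] Ω) := finite_points B Y Ω
  -- Induction on the image H of π₁(C) in the permutations of the fibre of Y, where C is the
  -- current, connected stage of the tower over B.
  suffices key : ∀ (H : Subgroup (Equiv.Perm (Y →ₐ[B] Ω))) (E C : Type u) [CommRing E] [CommRing C]
      [Algebra B C] [Algebra C Ω] [IsScalarTower B C Ω] [ConnectedSpace (PrimeSpectrum C)]
      (i : A →+* E) (φ : E →+* C), ArtinSchreierTower p f i (algebraMap B C) φ →
      ((MulAction.toPermHom (etalePi1 B Ω) (Y →ₐ[B] Ω)).comp (etalePi1Map B Ω C)).range = H →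
      ∃ (E C : Type u) (_ : CommRing E) (_ : CommRing C) (i : A →+* E) (j : B →+* C) (φ : E →+* C),
        ArtinSchreierTower p f i j φ ∧ ∃ (c : C →+* Ω) (h : Y →+* C), c.comp j = algebraMap B Ω ∧
          h.comp (algebraMap B Y) = j ∧ c.comp h = y.toRingHom from
    key _ A B _ _ .refl rfl
  intro H
  induction H using WellFoundedLT.induction with
  | ind H ih =>
  intro E C _ _ _ _ _ _ i φ hT hH
  obtain ⟨_, _⟩ := hT.charP
  set ψ := (MulAction.toPermHom (etalePi1 B Ω) (Y →ₐ[B] Ω)).comp (etalePi1Map B Ω C) with hψ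
  have hψp : IsPGroup p ψ.range := by
    refine IsPGroup.to_le hY ?_
    rintro _ ⟨γ, rfl⟩
    exact ⟨_, rfl⟩
  -- If π₁(C) acts trivially, the point y extends to a section over C, so C dominates Y.
  by_cases hbot : ψ.range = ⊥
  · have hfix : ∀ γ : etalePi1 C Ω, γ • liftPoint C y = liftPoint C y := fun γ => by
      refine Algebra.TensorProduct.ext (Subsingleton.elim _ _) (AlgHom.ext fun e => ?_)
      have h1 : ψ γ = 1 := (Subgroup.eq_bot_iff_forall _).1 hbot _ ⟨γ, rfl⟩
      have h2 : etalePi1Map B Ω C γ • y = y := Equiv.congr_fun h1 y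
      refine (DFunLike.congr_fun h2 e).trans ?_
      simp [liftPoint]
    obtain ⟨s, hs⟩ := exists_section_of_fixed _ hfix
    refine ⟨E, C, inferInstance, inferInstance, i, algebraMap B C, φ, hT, algebraMap C Ω,
      s.toRingHom.comp Algebra.TensorProduct.includeRight.toRingHom,
      (IsScalarTower.algebraMap_eq B C Ω).symm, ?_, ?_⟩
    · ext b
      change s (1 ⊗ₜ algebraMap B Y b) = _
      rw [Algebra.algebraMap_eq_smul_one (A := Y), ← TensorProduct.smul_tmul,
        ← Algebra.algebraMap_eq_smul_one]
      exact s.commutes _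
    · ext e
      refine (DFunLike.congr_fun hs (1 ⊗ₜ e)).trans ?_
      simp [liftPoint]
  obtain ⟨χ, hχ, hχH⟩ := exists_character ψ hψp ⊥ (bot_lt_iff_ne_bot.2 hbot)
  have hfin' : Finite (C ⊗[B] Y →ₐ[C] Ω) := finite_points C _ Ω
  obtain ⟨E', _, _, _, _, x₀, z, b, hz, hzx⟩ := exists_artinSchreier_of_character χ
    (isOpen_setOf_apply_eq_one (E := C ⊗[B] Y) χ fun γ hγ => hχH γ (by
      refine Subgroup.mem_bot.2 (Equiv.ext fun x => AlgHom.ext fun e => ?_)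
      refine (DFunLike.congr_fun (hγ (liftPoint C x)) (1 ⊗ₜ e)).trans ?_
      simp [liftPoint]))
  have : Nontrivial E' := x₀.toRingHom.domain_nontrivial
  have := charP_of_algebra C E' p
  obtain ⟨c, e, he⟩ := (hT.isFrobeniusIso hf).exists_sub_mem b
  obtain ⟨g, hg⟩ := exists_lift_apply (A := C) (p := p) (a := φ e) (z := z - algebraMap C E' c) (by
    rw [sub_pow_char, sub_eq_iff_eq_add.1 hz, he]
    simp only [map_sub, map_pow]; ring)
  let C' := ArtinSchreier p (φ e)
  let x₁ : C' →ₐ[C] Ω := x₀.comp g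
  have hx₁ : ∀ γ : etalePi1 C Ω, (γ • x₁) (AdjoinRoot.root _) =
      x₁ (AdjoinRoot.root _) + ((Multiplicative.toAdd (χ γ)).val : Ω) := fun γ => by
    rw [smul_comp, AlgHom.comp_apply, AlgHom.comp_apply, hg, map_sub, map_sub, hzx,
      AlgHom.commutes, AlgHom.commutes]
    ring
  -- χ is surjective, so π₁(C) reaches every translate of the root by the prime field and the
  -- monodromy is transitive.
  have hconn : ConnectedSpace (PrimeSpectrum C') := connectedSpace_of_transitive p x₁ fun x => by
    obtain ⟨k, hk⟩ := exists_eq_add_natCast (ArtinSchreier.root_pow_apply x₁)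
      (ArtinSchreier.root_pow_apply x)
    obtain ⟨γ, hγ⟩ := hχ (Multiplicative.ofAdd (k : ZMod p))
    refine ⟨γ, ArtinSchreier.algHom_ext ?_⟩
    rw [hx₁, hγ, hk, toAdd_ofAdd, ZMod.val_natCast, ← CharP.cast_eq_mod]
  let _ : Algebra C' Ω := x₁.toRingHom.toAlgebra
  have : IsScalarTower C C' Ω := .of_algebraMap_eq fun a => (x₁.commutes a).symm
  have : IsScalarTower B C' Ω := .of_algebraMap_eq fun a => by
    rw [IsScalarTower.algebraMap_apply B C Ω, IsScalarTower.algebraMap_apply C C' Ω,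
      IsScalarTower.algebraMap_apply B C C']
  have hχ1 : ∀ γ' : etalePi1 C' Ω, χ (etalePi1Map C Ω C' γ') = 1 := fun γ' => by
    have h1 := etalePi1Map_smul_apply γ' x₁ (Algebra.ofId C' Ω) (RingHom.id C') (fun _ => rfl)
      (fun _ => rfl) (AdjoinRoot.root _)
    rw [Subsingleton.elim (γ' • Algebra.ofId C' Ω) (Algebra.ofId C' Ω), hx₁] at h1
    exact eq_one_of_natCast_val_eq_zero (add_eq_left.1 h1)
  refine ih ((MulAction.toPermHom (etalePi1 B Ω) (Y →ₐ[B] Ω)).comp (etalePi1Map B Ω C')).range ?_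
    _ C' _ _ (hT.step e) rfl
  have hcomp : ∀ γ' : etalePi1 C' Ω, (MulAction.toPermHom (etalePi1 B Ω) (Y →ₐ[B] Ω))
      (etalePi1Map B Ω C' γ') = ψ (etalePi1Map C Ω C' γ') := fun γ' =>
    Equiv.ext fun x => (etalePi1Map_etalePi1Map_smul γ' x).symm
  rw [← hH]
  refine lt_of_le_of_ne ?_ fun heq => ?_
  · rintro _ ⟨γ', rfl⟩
    exact ⟨_, (hcomp γ').symm⟩
  -- χ vanishes on π₁(C') and depends only on the permutation of the fibre. If the images of π₁(C')
  -- and π₁(C) were equal, χ would be trivial.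
  · obtain ⟨γ, hγ⟩ := hχ (Multiplicative.ofAdd 1)
    obtain ⟨γ', hγ'⟩ := heq.ge ⟨γ, rfl⟩
    have h1 : ψ (γ * (etalePi1Map C Ω C' γ')⁻¹) = 1 := by
      rw [map_mul, map_inv, ← hcomp, mul_inv_eq_one]
      exact hγ'.symm
    have h2 := hχH _ (Subgroup.mem_bot.2 h1)
    rw [map_mul, map_inv, hχ1, inv_one, mul_one, hγ, ofAdd_eq_one] at h2
    exact one_ne_zero h2

/-- A δ in the kernel fixes the point of the tower over A. Its action on the point c' of C is
therefore trivial on the images of E and of B, which generate C, and y is a restriction of c'. -/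
theorem pTypicalPi1Map_injective [Algebra A B] [Algebra A Ω] [IsScalarTower A B Ω]
    [ConnectedSpace (PrimeSpectrum B)] (hf : IsFrobeniusIso p (algebraMap A B)) :
    Function.Injective (pTypicalPi1Map A Ω B p) := by
  rw [injective_iff_map_eq_one]
  intro δ hδ
  refine pTypicalPi1_ext fun Y _ _ _ _ hY y => ?_
  obtain ⟨E, C, _, _, i, j, φ, hT, c, h, hcj, hj, hch⟩ := exists_tower_of_isPTypical hf hY y
  let _ := i.toAlgebra
  let _ := j.toAlgebra
  have : Module.Finite A E := hT.etale.1.1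
  have : Algebra.Etale A E := hT.etale.1.2
  have : Module.Finite B C := hT.etale.2.1
  have : Algebra.Etale B C := hT.etale.2.2
  have hE : isPTypical A Ω p (.of A E) := isPTypical_iff.2 ((hT.exists_pow_smul_eq).1 rfl)
  have hC : isPTypical B Ω p (.of B C) := isPTypical_iff.2 ((hT.exists_pow_smul_eq).2 rfl)
  let c' : C →ₐ[B] Ω := { c with commutes' := fun b => DFunLike.congr_fun hcj b }
  let h' : Y →ₐ[B] C := { h with commutes' := fun b => DFunLike.congr_fun hj b }
  have hy : c'.comp h' = y := AlgHom.coe_ringHom_injective hch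
  have hφ : ∀ a, φ (algebraMap A E a) = algebraMap B C (algebraMap A B a) := fun a =>
    DFunLike.congr_fun hT.comp_eq a
  let x : E →ₐ[A] Ω :=
    { c.comp φ with
      commutes' := fun a => by
        change c (φ (algebraMap A E a)) = _
        rw [hφ, IsScalarTower.algebraMap_apply A B Ω]
        exact c'.commutes _ }
  have h1 := pTypicalPi1Map_pSmul_apply δ hE hC x c' φ hφ fun _ => rfl
  have h2 : pSmul δ hC c' = c' := by
    refine AlgHom.coe_ringHom_injective (hT.ringHom_ext ?_ ?_)
    · ext b
      exact ((pSmul δ hC c').commutes b).trans (c'.commutes b).symm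
    · ext e
      refine (h1 e).symm.trans ?_
      rw [hδ]
      rfl
  rw [← hy, pSmul_comp δ hY hC, h2]
  rfl

end Injectivity

section Homeomorph

variable {A B : Type u} [CommRing A] [CommRing B] {Ω : Type u} [Field Ω] [IsAlgClosed Ω]
  [Algebra A B] [Algebra A Ω] [Algebra B Ω] [IsScalarTower A B Ω] {p : ℕ}

/-- The topology on Aut F is induced from the product of the discrete finite groups Aut (F X), so
continuity can be tested one point at a time. -/
theorem continuous_aut_of_isOpen {𝒞 T : Type*} [Category* 𝒞] [TopologicalSpace T]
    {F : 𝒞 ⥤ FintypeCat.{u}} {g : T → Aut F}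
    (h : ∀ (X : 𝒞) (x y : F.obj X), IsOpen {t | (g t).hom.app X x = y}) : Continuous g := by
  refine continuous_induced_rng.2 (continuous_pi fun X => continuous_discrete_rng.2 fun a => ?_)
  have : (fun t => autEmbedding F (g t) X) ⁻¹' {a} =
      ⋂ x : F.obj X, {t | (g t).hom.app X x = a.hom x} := by
    ext t
    refine ⟨fun ht => Set.mem_iInter.2 fun x => ?_, fun ht => ?_⟩
    · exact ConcreteCategory.congr_hom (congrArg Iso.hom ht) x
    · exact Iso.ext (FintypeCat.hom_ext _ _ fun x => Set.mem_iInter.1 ht x)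
  exact this ▸ isOpen_iInter_of_finite fun x => h X x _

theorem continuous_pTypicalPi1Map : Continuous (pTypicalPi1Map A Ω B p) := by
  refine continuous_aut_of_isOpen fun X x y => ?_
  let E : Type u := X.unop.obj.obj
  have hE : isPTypical A Ω p (.of A E) := X.unop.property
  let x' : E →ₐ[A] Ω := x
  let y' : E →ₐ[A] Ω := y
  have hBE : isPTypical B Ω p (.of B (B ⊗[A] E)) := isPTypical_baseChange A Ω B p _ hE
  have h1 : ∀ (δ : pTypicalPi1 B Ω p) e, pSmul (pTypicalPi1Map A Ω B p δ) hE x' e =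
    pSmul δ hBE (liftPoint B x') (1 ⊗ₜ e) := fun _ _ => rfl
  have h2 : {δ | pSmul (pTypicalPi1Map A Ω B p δ) hE x' = y'} =
      {δ | pSmul δ hBE (liftPoint B x') = liftPoint B y'} := by
    ext δ
    refine ⟨fun h => Algebra.TensorProduct.ext (Subsingleton.elim _ _) (AlgHom.ext fun e => ?_),
      fun h => AlgHom.ext fun e => ?_⟩
    · refine (h1 δ e).symm.trans ((DFunLike.congr_fun h e).trans ?_)
      simp [liftPoint]
    · refine (h1 δ e).trans ((DFunLike.congr_fun h (1 ⊗ₜ e)).trans ?_)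
      simp [liftPoint]
  have h3 := (isClopen_setOf_pSmul_eq hBE (liftPoint B x') (liftPoint B y')).isOpen
  rw [← h2] at h3
  exact h3

theorem exists_continuousMulEquiv [hp : Fact p.Prime] [CharP A p] [CharP B p]
    [ConnectedSpace (PrimeSpectrum A)] [ConnectedSpace (PrimeSpectrum B)]
    (hf : IsFrobeniusIso p (algebraMap A B)) :
    ∃ e : pTypicalPi1 B Ω p ≃ₜ* pTypicalPi1 A Ω p, ∀ g, e g = pTypicalPi1Map A Ω B p g := by
  have : CharP Ω p := charP_of_algebra A Ω p
  let e := MulEquiv.ofBijective (pTypicalPi1Map A Ω B p)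
    ⟨pTypicalPi1Map_injective hf, pTypicalPi1Map_surjective hf⟩
  have hc : Continuous e := continuous_pTypicalPi1Map
  exact ⟨{ e with
    continuous_toFun := hc
    continuous_invFun := hc.continuous_symm_of_equiv_compact_to_t2 (f := e.toEquiv) }, fun _ => rfl⟩

end Homeomorph

end EtaleCover

end

/-! ### Contracting Frobenius and connectedness -/

open Topology in
/-- A homomorphism to a complete ring is an `IsFrobeniusIso` if it identifies the source with a
complement of a set of elements on which Frobenius is contracting. -/
theorem IsFrobeniusIso.of_contracting {p : ℕ} [hp : Fact p.Prime] {A B : Type*} [CommRing A]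
    [CommRing B] [UniformSpace B] [IsUniformAddGroup B] [IsTopologicalRing B] [CompleteSpace B]
    [T2Space B] [CharP B p] (f : A →+* B) (U : ℝ → AddSubgroup B) (hmono : Antitone U)
    (hmul : ∀ c d x y, x ∈ U c → y ∈ U d → x * y ∈ U (c + d))
    (hbasis : ∀ V ∈ 𝓝 (0 : B), ∃ c, (U c : Set B) ⊆ V) (hopen : ∀ c, IsOpen (U c : Set B))
    (hdec : ∀ b, ∃ a, ∃ c > 0, b - f a ∈ U c) (hinj : ∀ a, ∀ c > 0, f a ∈ U c → a = 0) :
    IsFrobeniusIso p f := by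
  have hpow : ∀ {c : ℝ} {u : B}, u ∈ U c → ∀ n : ℕ, u ^ (n + 1) ∈ U ((n + 1 : ℕ) * c) := by
    intro c u hu n
    induction n with
    | zero => simpa using hu
    | succ n ih =>
      have := hmul _ _ _ _ ih hu
      rw [← pow_succ] at this
      convert this using 2
      push_cast; ring
  have hpowp : ∀ {c : ℝ} {u : B}, 0 < c → u ∈ U c → ∀ k : ℕ, u ^ p ^ k ∈ U ((k + 1 : ℕ) * c) := by
    intro c u hc hu k
    -- This crude bound suffices: u^(p^k) lies in U((k + 1) c), and these levels go to infinity.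
    have h1 : k + 1 ≤ p ^ k := (Nat.lt_pow_self hp.out.one_lt)
    obtain ⟨n, hn⟩ : ∃ n, p ^ k = n + 1 := ⟨p ^ k - 1, by omega⟩
    rw [hn]
    refine hmono ?_ (hpow hu n)
    have : ((k + 1 : ℕ) : ℝ) ≤ (n + 1 : ℕ) := by exact_mod_cast hn ▸ h1
    gcongr
  have htend : ∀ {c : ℝ} {u : B}, 0 < c → u ∈ U c →
      Filter.Tendsto (fun k : ℕ => u ^ p ^ k) Filter.atTop (𝓝 0) := by
    intro c u hc hu
    refine Filter.tendsto_def.2 fun V hV => ?_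
    obtain ⟨d, hd⟩ := hbasis V hV
    obtain ⟨K, hK⟩ := exists_nat_ge (d / c)
    refine Filter.mem_atTop_sets.2 ⟨K, fun k hk => hd (hmono ?_ (hpowp hc hu k))⟩
    rw [div_le_iff₀ hc] at hK
    refine hK.trans ?_
    have : (K : ℝ) ≤ (k + 1 : ℕ) := by exact_mod_cast hk.trans k.le_succ
    gcongr
  have hna : NonarchimedeanAddGroup B := ⟨fun V hV => by
    obtain ⟨c, hc⟩ := hbasis V hV
    exact ⟨⟨U c, hopen c⟩, hc⟩⟩
  refine ⟨?_, fun b hb => ?_, fun b => ?_⟩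
  · rw [injective_iff_map_eq_zero]
    intro a ha
    exact hinj a 1 one_pos (ha ▸ (U 1).zero_mem)
  · obtain ⟨a, c, hc, hu⟩ := hdec b
    obtain ⟨a', ha'⟩ := hb
    have hup : (b - f a) ^ p ∈ U c := by
      have := hpowp hc hu 1
      rw [pow_one] at this
      refine hmono ?_ this
      push_cast; linarith
    -- With u = b - f a, the image of this element is u^p - u, which lies in U c, where f has no
    -- nonzero values. So u^p = u, and u = u^(p^k) tends to 0.
    have h1 : a' - (a ^ p - a) = 0 := by
      refine hinj _ c hc ?_
      convert (U c).sub_mem hup hu using 1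
      rw [sub_pow_char]
      simp only [map_sub, map_pow, ha']
      ring
    have h2 : (b - f a) ^ p = b - f a := by
      rw [← sub_eq_zero, sub_pow_char]
      have := congrArg f h1
      simp only [map_sub, map_pow, ha', map_zero] at this
      rw [← this]; ring
    have h3 : ∀ k : ℕ, (b - f a) ^ p ^ k = b - f a := fun k => by
      induction k with
      | zero => simp
      | succ k ih => rw [pow_succ, pow_mul, ih, h2]
    have h4 := htend hc hu
    simp only [h3] at h4
    exact ⟨a, (sub_eq_zero.1 (tendsto_nhds_unique tendsto_const_nhds h4)).symm⟩
  · obtain ⟨a, c, hc, hu⟩ := hdec b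
    have hs : Summable fun k : ℕ => (b - f a) ^ p ^ k :=
      NonarchimedeanAddGroup.summable_of_tendsto_cofinite_zero (by
        rw [Nat.cofinite_eq_atTop]; exact htend hc hu)
    have h1 := hs.hasSum.map (frobenius B p) (continuous_pow p)
    have h2 := hs.tsum_eq_zero_add
    have h3 : (∑' k : ℕ, (b - f a) ^ p ^ k) ^ p = ∑' k : ℕ, (b - f a) ^ p ^ (k + 1) := by
      rw [← frobenius_def, ← h1.tsum_eq]
      refine tsum_congr fun k => ?_
      rw [Function.comp_apply, frobenius_def, ← pow_mul, ← pow_succ]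
    -- With w the sum of the u^(p^k) one has w^p = w - u, so c = -w satisfies c^p - c = u.
    refine ⟨-∑' k : ℕ, (b - f a) ^ p ^ k, a, ?_⟩
    have h4 : (-∑' k : ℕ, (b - f a) ^ p ^ k) ^ p = -(∑' k : ℕ, (b - f a) ^ p ^ k) ^ p := by
      rw [← frobenius_def, ← frobenius_def, map_neg]
    rw [h4, h3]
    rw [pow_zero, pow_one] at h2
    generalize (∑' k : ℕ, (b - f a) ^ p ^ k) = w at *
    rw [h2]
    ring

theorem IsFrobeniusIso.connectedSpace {p : ℕ} [hp : Fact p.Prime] {A B : Type*} [CommRing A]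
    [CommRing B] {f : A →+* B} (hf : IsFrobeniusIso p f) [ConnectedSpace (PrimeSpectrum A)] :
    ConnectedSpace (PrimeSpectrum B) := by
  have := nontrivial_of_connectedSpace_primeSpectrum A
  refine connectedSpace_primeSpectrum_iff.2 ⟨hf.injective.nontrivial, fun e he => ?_⟩
  obtain ⟨a, rfl⟩ := hf.mem_range e ⟨0, by rw [he.pow_eq hp.out.ne_zero, sub_self, map_zero]⟩
  have ha : IsIdempotentElem a := hf.injective (by rw [map_mul]; exact he)
  rcases eq_zero_or_one_of_isIdempotentElem ha with rfl | rfl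
  · exact Or.inl (map_zero f)
  · exact Or.inr (map_one f)

section AddMonoidAlgebra

variable {p : ℕ} [hp : Fact p.Prime] {R M : Type*} [CommRing R] [CharP R p] [AddCommMonoid M]

/-- Frobenius is additive, so x^p is the sum of the c_w^p [p w]. -/
theorem AddMonoidAlgebra.exists_nsmul_eq_of_coeff_pow_ne_zero (x : AddMonoidAlgebra R M) {v : M}
    (hv : (x ^ p).coeff v ≠ 0) : ∃ w, x.coeff w ≠ 0 ∧ p • w = v := by
  have := CharP.nontrivial_of_char_ne_one (R := R) hp.out.ne_one
  have : CharP (AddMonoidAlgebra R M) p := EtaleCover.charP_of_algebra R _ p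
  classical
  by_contra! h
  apply hv
  conv_lhs => rw [← AddMonoidAlgebra.sum_coeff_single x]
  rw [Finsupp.sum, sum_pow_char, AddMonoidAlgebra.coeff_sum, Finsupp.finsetSum_apply]
  refine Finset.sum_eq_zero fun w hw => ?_
  rw [AddMonoidAlgebra.single_pow, AddMonoidAlgebra.coeff_single,
    Finsupp.single_eq_of_ne (h w (Finsupp.mem_support_iff.1 hw)).symm]

/-- An idempotent equals its p-th power, so each exponent in its support is p times another one.
Descent on the size leaves only the exponent 0, and the idempotent comes from R. -/
theorem AddMonoidAlgebra.connectedSpace [ConnectedSpace (PrimeSpectrum R)] (size : M → ℕ)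
    (hsize : ∀ v, size (p • v) = p * size v) (hzero : ∀ v, size v = 0 → v = 0) :
    ConnectedSpace (PrimeSpectrum (AddMonoidAlgebra R M)) := by
  have := nontrivial_of_connectedSpace_primeSpectrum R
  refine connectedSpace_primeSpectrum_iff.2 ⟨inferInstance, fun e he => ?_⟩
  have hsupp : ∀ n : ℕ, ∀ v, size v = n → e.coeff v ≠ 0 → v = 0 := by
    intro n
    induction n using Nat.strong_induction_on with
    | _ n ih =>
      rintro v hn hv
      rw [← he.pow_eq hp.out.ne_zero] at hv
      obtain ⟨w, hw, rfl⟩ := exists_nsmul_eq_of_coeff_pow_ne_zero e hv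
      by_cases h0 : size w = 0
      · rw [hzero w h0, smul_zero]
      · rw [ih (size w) ?_ w rfl hw, smul_zero]
        rw [← hn, hsize]
        exact lt_mul_left (Nat.pos_of_ne_zero h0) hp.out.one_lt
  have he' : e = AddMonoidAlgebra.single 0 (e.coeff 0) := by
    ext v
    rw [AddMonoidAlgebra.coeff_single]
    by_cases hv : v = 0
    · subst hv; simp
    · rw [Finsupp.single_eq_of_ne hv]
      by_contra h
      exact hv (hsupp _ v rfl h)
  have hr : IsIdempotentElem (e.coeff 0) := by
    have h1 := he.eq
    rw [he', AddMonoidAlgebra.single_mul_single, add_zero] at h1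
    have h2 := congrArg (fun x => AddMonoidAlgebra.coeff x 0) h1
    simp only [AddMonoidAlgebra.coeff_single, Finsupp.single_eq_same] at h2
    exact h2
  rcases eq_zero_or_one_of_isIdempotentElem hr with h | h
  · left; rw [he', h, AddMonoidAlgebra.single_zero]
  · right; rw [he', h]; rfl

end AddMonoidAlgebra

/-! ### Cone rings and their completions -/

section ConeRing

variable {n : ℕ} {R : Type u} [CommRing R]

theorem connectedSpace_coneRing (p : ℕ) [hp : Fact p.Prime] [CharP R p]
    [ConnectedSpace (PrimeSpectrum R)] (τ : PointedCone ℝ (Fin n → ℝ)) :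
    ConnectedSpace (PrimeSpectrum (ConeRing R τ)) :=
  -- The size is the ℓ¹-norm of the lattice point; no finiteness of the cone is needed.
  AddMonoidAlgebra.connectedSpace (p := p) (fun v => ∑ i, (v.1 i).natAbs)
    (fun v => by simp [Finset.mul_sum, Int.natAbs_mul])
    (fun v hv => by
      ext i
      simpa using Finset.sum_eq_zero_iff.1 hv i (Finset.mem_univ i))

variable (σ : PointedCone ℝ (Fin n → ℝ)) (l : (Fin n → ℝ) →ₗ[ℝ] ℝ)

theorem coeff_coneRingInclusion {τ : PointedCone ℝ (Fin n → ℝ)} (h : τ ≤ σ) (a : ConeRing R τ)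
    (v : latticePoints τ) : (coneRingInclusion R h a).coeff ⟨v.1, h v.2⟩ = a.coeff v :=
  Finsupp.mapDomain_apply (AddSubmonoid.inclusion_injective
    (S := latticePoints τ) (T := latticePoints σ) fun _ hv => h hv) a.coeff v

theorem eq_zero_of_mem_coneValGE (a : ConeRing R (cutCone σ l)) {c : ℝ} (hc : 0 < c)
    (ha : coneRingInclusion R (τ := cutCone σ l) (σ := σ) (fun _ hv => hv.1) a ∈ coneValGE σ l c) :
    a = 0 := by
  ext v
  by_contra hv
  have h1 := (le_coneVal_iff l _ c).1 ha ⟨v.1, v.2.1⟩ (by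
    rw [coeff_coneRingInclusion]; exact hv)
  exact absurd (h1.trans v.2.2) (not_le.2 hc)

/-- Keep the monomials with λ ≤ 0. The remaining ones are finite in number, so their values of λ
have a positive lower bound c, though none uniform in x. -/
theorem exists_sub_mem_coneValGE (x : ConeRing R σ) :
    ∃ (a : ConeRing R (cutCone σ l)) (c : ℝ), 0 < c ∧
      x - coneRingInclusion R (τ := cutCone σ l) (σ := σ) (fun _ hv => hv.1) a ∈
        coneValGE σ l c := by
  classical
  induction x using AddMonoidAlgebra.induction_linear with
  | zero => exact ⟨0, 1, one_pos, by rw [map_zero, sub_zero]; exact AddSubgroup.zero_mem _⟩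
  | add x y hx hy =>
    obtain ⟨a, c, hc, ha⟩ := hx
    obtain ⟨b, d, hd, hb⟩ := hy
    have mono : ∀ {c d : ℝ}, c ≤ d → coneValGE (R := R) σ l d ≤ coneValGE σ l c :=
      fun h x hx => le_trans (WithTop.coe_le_coe.2 h) hx
    refine ⟨a + b, min c d, lt_min hc hd, ?_⟩
    rw [map_add, add_sub_add_comm]
    exact AddSubgroup.add_mem _ (mono (min_le_left _ _) ha) (mono (min_le_right _ _) hb)
  | single v r =>
    by_cases hv : latticeValue l v ≤ 0
    · refine ⟨AddMonoidAlgebra.single ⟨v.1, v.2, hv⟩ r, 1, one_pos, ?_⟩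
      convert AddSubgroup.zero_mem _
      rw [sub_eq_zero, coneRingInclusion, AddMonoidAlgebra.mapDomainRingHom_apply,
        AddMonoidAlgebra.mapDomain_single]
      rfl
    · refine ⟨0, latticeValue l v, not_le.1 hv, ?_⟩
      rw [map_zero, sub_zero]
      refine (le_coneVal_iff l _ _).2 fun w hw => ?_
      by_cases hvw : w = v
      · rw [hvw]
      · exact absurd (by rw [AddMonoidAlgebra.coeff_single, Finsupp.single_eq_of_ne hvw]) hw

open Topology UniformSpace in
-- `IsFrobeniusIso.of_contracting` applies to the closures U c of the subgroups {v_λ ≥ c}.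
theorem isFrobeniusIso_coneCompletion (p : ℕ) [hp : Fact p.Prime] [CharP R p]
    [ConnectedSpace (PrimeSpectrum R)] :
    IsFrobeniusIso p (algebraMap (ConeRing R (cutCone σ l)) (ConeCompletion R σ l)) := by
  let S := ValuedConeRing R σ l
  let ι : S →+* Completion S := Completion.coeRingHom
  let G : ℝ → AddSubgroup S := coneValGE σ l
  have hG : (𝓝 (0 : S)).HasBasis (fun _ => True) fun c => (G c : Set S) :=
    (coneValGE_basis (R := R) σ l).hasBasis_nhds_zero
  have hGo : ∀ c, IsOpen (G c : Set S) := fun c =>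
    AddSubgroup.isOpen_of_mem_nhds _ (hG.mem_of_mem trivial)
  have hGc : ∀ c, IsClosed (G c : Set S) := fun c => AddSubgroup.isClosed_of_isOpen _ (hGo c)
  have hGm : Antitone G := fun c d h x hx => le_trans (WithTop.coe_le_coe.2 h) hx
  let U : ℝ → AddSubgroup (Completion S) := fun c => ((G c).map ι.toAddMonoidHom).topologicalClosure
  have hUcoe : ∀ c, (U c : Set (Completion S)) = closure ((fun s : S => (s : Completion S)) '' G c) :=
    fun c => rfl
  have hU : (𝓝 (0 : Completion S)).HasBasis (fun _ => True) fun c => (U c : Set (Completion S)) :=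
    hG.hasBasis_of_isDenseInducing Completion.isDenseInducing_coe
  have hUo : ∀ c, IsOpen (U c : Set (Completion S)) := fun c =>
    AddSubgroup.isOpen_of_mem_nhds _ (hU.mem_of_mem trivial)
  have hUι : ∀ {c s}, s ∈ G c → ι s ∈ U c := fun hs => subset_closure ⟨_, hs, rfl⟩
  -- G c is open and hence closed, so taking its closure in the completion adds no new elements of
  -- R_σ.
  have hιU : ∀ {c s}, ι s ∈ U c → s ∈ G c := fun {c s} hs => by
    have h1 := Completion.isDenseInducing_coe.isInducing.closure_eq_preimage_closure_image
      (G c : Set S)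
    rw [(hGc c).closure_eq] at h1
    exact (Set.ext_iff.1 h1 s).2 hs
  have hUm : Antitone U := fun c d h => AddSubgroup.topologicalClosure_mono
    (AddSubgroup.map_mono (hGm h))
  have : Nontrivial (ConeCompletion R σ l) := by
    have := connectedSpace_coneRing (R := R) p (cutCone σ l)
    have := nontrivial_of_connectedSpace_primeSpectrum (ConeRing R (cutCone σ l))
    refine ⟨1, 0, fun h => ?_⟩
    have h1 : ι 1 ∈ U 1 := by rw [map_one, h]; exact (U 1).zero_mem
    refine one_ne_zero (eq_zero_of_mem_coneValGE σ l (1 : ConeRing R (cutCone σ l)) one_pos ?_)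
    rw [map_one]
    exact hιU h1
  have : CharP (ConeRing R (cutCone σ l)) p := by
    have := connectedSpace_coneRing (R := R) p (cutCone σ l)
    have := nontrivial_of_connectedSpace_primeSpectrum (ConeRing R (cutCone σ l))
    exact EtaleCover.charP_of_algebra R _ p
  have : CharP (ConeCompletion R σ l) p :=
    EtaleCover.charP_of_algebra (ConeRing R (cutCone σ l)) _ p
  refine .of_contracting _ U hUm (fun c d x y hx hy => ?_) (fun V hV => ?_) hUo (fun b => ?_)
    fun a c hc ha => eq_zero_of_mem_coneValGE σ l a hc (hιU ha)
  · refine map_mem_closure₂ continuous_mul hx hy ?_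
    rintro _ ⟨s, hs, rfl⟩ _ ⟨t, ht, rfl⟩
    exact ⟨s * t, coneValGE_mul l hs ht, map_mul ι s t⟩
  · obtain ⟨c, -, hc⟩ := hU.mem_iff.1 hV
    exact ⟨c, hc⟩
  -- By density b is approximated by an element of R_σ up to valuation 1. Any positive bound would
  -- serve.
  · obtain ⟨s, hs⟩ : ∃ s : S, b - ι s ∈ U 1 := by
      have h1 : IsOpen {b' | b - b' ∈ U 1} := (hUo 1).preimage (continuous_const.sub continuous_id)
      obtain ⟨_, hs, s, rfl⟩ := (Completion.denseRange_coe (α := S)).inter_open_nonempty _ h1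
        ⟨b, by rw [Set.mem_ofPred_eq, sub_self]; exact (U 1).zero_mem⟩
      exact ⟨s, hs⟩
    obtain ⟨a, c, hc, ha⟩ := exists_sub_mem_coneValGE σ l s
    refine ⟨a, min 1 c, lt_min one_pos hc, ?_⟩
    have h2 := (U (min 1 c)).add_mem (hUm (min_le_left _ _) hs) (hUm (min_le_right _ _) (hUι ha))
    convert h2 using 1
    have h3 := map_sub ι s (coneRingInclusion R (τ := cutCone σ l) (σ := σ) (fun _ hv => hv.1) a)
    refine Eq.trans ?_ (congrArg (b - ι s + ·) h3.symm)
    rw [sub_add_sub_cancel]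
    rfl

end ConeRing

theorem mainTheorem8 (p : ℕ) [Fact p.Prime] (R : Type u) [CommRing R] [CharP R p]
    [ConnectedSpace (PrimeSpectrum R)] (n : ℕ) (σ : PointedCone ℝ (Fin n → ℝ))
    (l : (Fin n → ℝ) →ₗ[ℝ] ℝ) :
    ConnectedSpace (PrimeSpectrum (ConeCompletion R σ l)) ∧
    ConnectedSpace (PrimeSpectrum (ConeRing R (cutCone σ l))) ∧
    ∀ (Ω : Type u) [Field Ω] [IsAlgClosed Ω] [Algebra (ConeCompletion R σ l) Ω]
      [Algebra (ConeRing R (cutCone σ l)) Ω]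
      [IsScalarTower (ConeRing R (cutCone σ l)) (ConeCompletion R σ l) Ω],
      ∃ e : pTypicalPi1 (ConeCompletion R σ l) Ω p ≃ₜ*
          pTypicalPi1 (ConeRing R (cutCone σ l)) Ω p,
        ∀ g, e g = pTypicalPi1Map (ConeRing R (cutCone σ l)) Ω (ConeCompletion R σ l) p g := by
  have hA := connectedSpace_coneRing (R := R) p (cutCone σ l)
  have hf := isFrobeniusIso_coneCompletion (R := R) σ l p
  have hB := hf.connectedSpace
  have := nontrivial_of_connectedSpace_primeSpectrum (ConeRing R (cutCone σ l))
  have := nontrivial_of_connectedSpace_primeSpectrum (ConeCompletion R σ l)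
  have : CharP (ConeRing R (cutCone σ l)) p := EtaleCover.charP_of_algebra R _ p
  have : CharP (ConeCompletion R σ l) p :=
    EtaleCover.charP_of_algebra (ConeRing R (cutCone σ l)) _ p
  exact ⟨hB, hA, fun Ω _ _ _ _ _ => EtaleCover.exists_continuousMulEquiv hf⟩
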